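/- Let $\mathbb D^2=\{z\in\mathbb C^2:|z_1|,|z_2|<1\}$ and $\mathbb T^2=\{z\in\mathbb C^2:|z_1|=|z_2|=1\}$. Let $S:\mathbb D^2\to\mathbb C^{M\times N}$ be a rational matrix function with no poles in $\mathbb D^2$; that is, there are $Q\in\mathbb C^{M\times N}[z_1,z_2]$ and a nonzero $p\in\mathbb C[z_1,z_2]$ such that every point $\zeta\in\mathbb D^2$ admits a representation $Q/p=Q'/p'$ of the same rational function, with $Q'\in\mathbb C^{M\times N}[z_1,z_2]$, $p'\in\mathbb C[z_1,z_2]$ and $p'(\zeta)\neq0$, for which $S(\zeta)=Q'(\zeta)/p'(\zeta)$. Assume that $S=Q/p$ satisfies $S(z)^*S(z)=I_N$ for all $z\in\mathbb T^2$ with $p(z)\ne 0$. Then there exist an integer $r\ge 0$, an $(M+r)\times(N+r)$ complex matrix $U=\begin{pmatrix}A&B\\C&D\end{pmatrix}$ with $A\in\mathbb C^{M\times N}$ and $D\in\mathbb C^{r\times r}$ that is isometric ($U^*U=I_{N+r}$), and orthogonal projections $P_1,P_2\in\mathbb C^{r\times r}$ with $P_1+P_2=I_r$, such that, with $\Delta(z)=z_1P_1+z_2P_2$,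 for every $z\in\mathbb D^2$ the matrix $I_r-D\Delta(z)$ is invertible and $$S(z)=A+B\,\Delta(z)\,(I_r-D\Delta(z))^{-1}C.$$ -/

import Mathlib

/-- The open unit bidisk `𝔻²` in `ℂ²`. -/
def bidisk : Set (Fin 2 → ℂ) := {z | ‖z 0‖ < 1 ∧ ‖z 1‖ < 1}

/-- The two-torus `𝕋²` in `ℂ²`. -/
def bitorus : Set (Fin 2 → ℂ) := {z | ‖z 0‖ = 1 ∧ ‖z 1‖ = 1}

/-- The value at `z ∈ ℂ²` of a matrix of polynomials in two variables. -/
noncomputable def evalMatrix {M N : ℕ} (z : Fin 2 → ℂ)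
    (Q : Matrix (Fin M) (Fin N) (MvPolynomial (Fin 2) ℂ)) : Matrix (Fin M) (Fin N) ℂ :=
  Q.map (MvPolynomial.eval z)

/-- The rational matrix function `Q / p` (where `p ≠ 0`) has no pole at `z`, and its value there
is `W`: some representation `Q' / p'` of the same rational function has a denominator which does
not vanish at `z`, and `W = Q'(z) / p'(z)`. -/
def HasFractionValueAt {M N : ℕ} (Q : Matrix (Fin M) (Fin N) (MvPolynomial (Fin 2) ℂ))
    (p : MvPolynomial (Fin 2) ℂ) (z : Fin 2 → ℂ) (W : Matrix (Fin M) (Fin N) ℂ) : Prop :=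
  ∃ (Q' : Matrix (Fin M) (Fin N) (MvPolynomial (Fin 2) ℂ)) (p' : MvPolynomial (Fin 2) ℂ),
    MvPolynomial.eval z p' ≠ 0 ∧ p' • Q = p • Q' ∧
      W = (MvPolynomial.eval z p')⁻¹ • evalMatrix z Q'

/-- The linear matrix pencil `Δ(z) = z₁ P₁ + z₂ P₂`. -/
noncomputable def pencil {r : ℕ} (P₁ P₂ : Matrix (Fin r) (Fin r) ℂ) (z : Fin 2 → ℂ) :
    Matrix (Fin r) (Fin r) ℂ :=
  z 0 • P₁ + z 1 • P₂

/-! In lowest terms `S = Q/p`, where `p` has no zeros in the bidisk and `Q* Q = |p|²` on the torus.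
Let `n` bound the degrees of `p` and `Q` in each variable. By Parseval, `‖Qc‖ = ‖pc‖` for every
polynomial vector `c`, norms being taken on coefficients. The aim is to localize this global
identity in the top coefficients, at `z₁ⁿ z₂ⁿ`, with finite-dimensional corrections: linear maps
`F₀`, `F₁` such that `‖(pc)ₙₙ‖² + ‖F₀(z₁c)‖² + ‖F₁(z₂c)‖² = ‖(Qc)ₙₙ‖² + ‖F₀c‖² + ‖F₁c‖²`
(`exists_energy_balance`).

The maps come from two truncations. Multiplication by `S` is a contraction commuting with shifts, so
truncating `pc` and `Qc` modulo `z₂ⁿ⁺¹` leaves a nonnegative defect (`norm_head_toSeq_le`).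
Multiplication by `z₁` is an isometry for this defect form, and the Wold decomposition realizes it
as a shift of finite multiplicity: the defect is `‖Ac‖²` with `A` intertwining `z₁` and the shift
(`exists_outer_factor`). Telescoping in `z₂` makes `(row n of pc, A(z₂c)) ↦ (row n of Qc, Ac)`
isometric. Truncating this modulo `z₁ⁿ⁺¹` gives a second nonnegative defect `‖F₀c‖²`; telescoping in
`z₁` gives the balance, with `F₁c` the entry `n` of `Ac`. Finiteness holds because everything
factors through polynomials modulo high powers of the variables.

The balance says that `((pc)ₙₙ, F(zc)) ↦ ((Qc)ₙₙ, Fc)` is isometric, and since `N ≤ M` it extends to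
an isometric matrix `U` (`exists_isometric_matrix`). Applied to `v` times a product of geometric
sums based at a point `w`, it reads `U(p(w)v, Δ(w)x) = (Q(w)v, x)`; eliminating `x` gives the
formula for `S(w)`. -/

open scoped InnerProductSpace

/-! ### Square-summable sequences, shifts and truncations -/

/-- The Hilbert space of square summable sequences with values in `V`. -/
abbrev ell2 (V : Type*) [NormedAddCommGroup V] := lp (fun _ : ℕ => V) 2

namespace ell2

variable {V : Type*} [NormedAddCommGroup V]

theorem summable_norm_sq (f : ell2 V) : Summable fun i => ‖f i‖ ^ 2 := by
  have := (lp.memℓp f).summable (by norm_num)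
  simpa using this

theorem hasSum_norm_sq (f : ell2 V) : HasSum (fun i => ‖f i‖ ^ 2) (‖f‖ ^ 2) := by
  have := lp.hasSum_norm (p := 2) (by norm_num) f
  simpa using this

theorem memℓp_of_summable {f : ℕ → V} (h : Summable fun i => ‖f i‖ ^ 2) : Memℓp f 2 :=
  memℓp_gen (by simpa using h)

theorem norm_sq_eq_sum {f : ell2 V} {n : ℕ} (h : ∀ i, n ≤ i → f i = 0) :
    ‖f‖ ^ 2 = ∑ i ∈ Finset.range n, ‖f i‖ ^ 2 := by
  rw [← (hasSum_norm_sq f).tsum_eq]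
  refine tsum_eq_sum fun i hi => ?_
  rw [h i (by simpa using hi)]
  simp

/-- A finitely supported sequence, as an element of `ell2`. -/
noncomputable def ofFinite (f : ℕ → V) (hf : {i | f i ≠ 0}.Finite) : ell2 V :=
  ⟨f, (memℓp_zero hf).of_exponent_ge zero_le⟩

variable [InnerProductSpace ℂ V]

theorem inner_eq_zero_of_forall {f g : ell2 V} (h : ∀ i, ⟪f i, g i⟫_ℂ = 0) : ⟪f, g⟫_ℂ = 0 := by
  rw [lp.inner_eq_tsum]
  simp [h]

/-- The `n`-fold unilateral shift. -/
noncomputable def shift (n : ℕ) : ell2 V →ₗᵢ[ℂ] ell2 V where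
  toFun f := ⟨fun i => if i < n then 0 else f (i - n), memℓp_of_summable <| by
    rw [← summable_nat_add_iff n]
    simpa using summable_norm_sq f⟩
  map_add' f g := by
    ext i
    change (if i < n then (0 : V) else f (i - n) + g (i - n)) =
      (if i < n then 0 else f (i - n)) + if i < n then 0 else g (i - n)
    split_ifs <;> simp
  map_smul' a f := by
    ext i
    by_cases h : i < n <;> simp [h]
  norm_map' f := by
    rw [← sq_eq_sq₀ (norm_nonneg _) (norm_nonneg _), ← (hasSum_norm_sq _).tsum_eq,
      ← (hasSum_norm_sq f).tsum_eq, ← (summable_norm_sq _).sum_add_tsum_nat_add n]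
    rw [Finset.sum_eq_zero]
    · simp
    · intro i hi
      simp [Finset.mem_range.1 hi]

theorem shift_apply (n : ℕ) (f : ell2 V) (i : ℕ) :
    shift n f i = if i < n then 0 else f (i - n) := rfl

theorem shift_apply_of_lt {n i : ℕ} (h : i < n) (f : ell2 V) : shift n f i = 0 := by
  simp [shift_apply, h]

@[simp] theorem shift_apply_add (n i : ℕ) (f : ell2 V) : shift n f (i + n) = f i := by
  simp [shift_apply]

/-- The `n`-fold backward shift. -/
noncomputable def drop (n : ℕ) : ell2 V →ₗ[ℂ] ell2 V where
  toFun f := ⟨fun i => f (i + n), memℓp_of_summable <|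
    (summable_nat_add_iff n).2 (summable_norm_sq f)⟩
  map_add' f g := rfl
  map_smul' a f := by ext i; simp

@[simp] theorem drop_apply (n : ℕ) (f : ell2 V) (i : ℕ) : drop n f i = f (i + n) := rfl

/-- Truncation to the first `n` entries. -/
noncomputable def head (n : ℕ) : ell2 V →ₗ[ℂ] ell2 V :=
  LinearMap.id - (shift n).toLinearMap ∘ₗ drop n

theorem head_eq_sub (n : ℕ) (f : ell2 V) : head n f = f - shift n (drop n f) := rfl

theorem head_apply (n : ℕ) (f : ell2 V) (i : ℕ) : head n f i = if i < n then f i else 0 := by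
  rw [head_eq_sub, lp.coeFn_sub, Pi.sub_apply, shift_apply]
  split_ifs with h
  · simp
  · rw [drop_apply, Nat.sub_add_cancel (not_lt.1 h), sub_self]

theorem norm_head_sq (n : ℕ) (f : ell2 V) :
    ‖head n f‖ ^ 2 = ∑ i ∈ Finset.range n, ‖f i‖ ^ 2 := by
  rw [norm_sq_eq_sum (n := n) fun i hi => by rw [head_apply, if_neg (not_lt.2 hi)]]
  exact Finset.sum_congr rfl fun i hi => by rw [head_apply, if_pos (Finset.mem_range.1 hi)]

theorem norm_head_le (n : ℕ) (f : ell2 V) : ‖head n f‖ ≤ ‖f‖ := by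
  rw [← sq_le_sq₀ (norm_nonneg _) (norm_nonneg _), norm_head_sq]
  exact sum_le_hasSum _ (fun i _ => sq_nonneg _) (hasSum_norm_sq f)

theorem head_eq_self {n : ℕ} {f : ell2 V} (h : ∀ i, n ≤ i → f i = 0) : head n f = f := by
  ext i
  rw [head_apply]
  split_ifs with hi
  · rfl
  · rw [h i (not_lt.1 hi)]

theorem head_shift (n : ℕ) (f : ell2 V) : head n (shift n f) = 0 := by
  ext i
  rw [head_apply]
  split_ifs with hi
  · simp [shift_apply, hi]
  · simp

/-- A closed subspace containing all finitely supported sequences is everything. -/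
theorem mem_of_forall_single {W : Submodule ℂ (ell2 V)} (hW : IsClosed (W : Set (ell2 V)))
    (h : ∀ (i : ℕ) (v : V), lp.single 2 i v ∈ W) (f : ell2 V) : f ∈ W :=
  hW.mem_of_tendsto (lp.hasSum_single (by norm_num) f)
    (Filter.Eventually.of_forall fun s => W.sum_mem fun i _ => h i _)

end ell2

/-! ### Intertwining contractions and defect forms -/

/-- A contraction intertwining two isometries, given on a dense set, does not increase the
distance to the range. -/
theorem le_norm_sub_of_contraction {P H₁ H₂ : Type*} [AddCommGroup P] [Module ℂ P]
    [NormedAddCommGroup H₁] [NormedSpace ℂ H₁] [NormedAddCommGroup H₂] [NormedSpace ℂ H₂]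
    (x : P →ₗ[ℂ] H₁) (y : P →ₗ[ℂ] H₂) (hxy : ∀ c, ‖y c‖ ≤ ‖x c‖) (hx : DenseRange x)
    (Z : P →ₗ[ℂ] P) (T : H₁ →ₗᵢ[ℂ] H₁) (hT : ∀ c, x (Z c) = T (x c)) (c : P) (ρ : ℝ)
    (hρ : ∀ c', ρ ≤ ‖y (c - Z c')‖) (g : H₁) : ρ ≤ ‖x c - T g‖ := by
  -- The inequality is closed in `g`, so `g = x c'` suffices; then `T g = x (Z c')` and the
  -- contraction applies to `c - Z c'`.
  refine hx.induction_on (p := fun g => ρ ≤ ‖x c - T g‖) g ?_ fun c' => ?_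
  · exact isClosed_le continuous_const (by fun_prop)
  · calc ρ ≤ ‖y (c - Z c')‖ := hρ c'
      _ ≤ ‖x (c - Z c')‖ := hxy _
      _ = ‖x c - T (x c')‖ := by rw [map_sub, hT]

/-- The norm of `head n f` is the distance from `f` to the range of `shift n`, attained at `shift n
(drop n f)`. An intertwining contraction cannot increase this distance. -/
theorem norm_head_le_of_contraction {P V W : Type*} [AddCommGroup P] [Module ℂ P]
    [NormedAddCommGroup V] [InnerProductSpace ℂ V] [NormedAddCommGroup W] [InnerProductSpace ℂ W]
    (x : P →ₗ[ℂ] ell2 V) (y : P →ₗ[ℂ] ell2 W) (hxy : ∀ c, ‖y c‖ ≤ ‖x c‖) (hx : DenseRange x)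
    (n : ℕ) (Z : P →ₗ[ℂ] P) (hxZ : ∀ c, x (Z c) = ell2.shift n (x c))
    (hyZ : ∀ c, y (Z c) = ell2.shift n (y c)) (c : P) :
    ‖ell2.head n (y c)‖ ≤ ‖ell2.head n (x c)‖ := by
  refine le_norm_sub_of_contraction x y hxy hx Z (ell2.shift n) hxZ c _ (fun c' => ?_)
    (ell2.drop n (x c))
  have : ell2.head n (y c) = ell2.head n (y (c - Z c')) := by
    rw [map_sub, hyZ, map_sub, ell2.head_shift, sub_zero]
  rw [this]
  exact ell2.norm_head_le _ _

/-- The Hilbert space of the positive semidefinite form `⟪x c, x c'⟫ - ⟪y c, y c'⟫`. -/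
theorem exists_defect_space {P : Type} {H₁ H₂ : Type*} [AddCommGroup P] [Module ℂ P]
    [NormedAddCommGroup H₁] [InnerProductSpace ℂ H₁] [NormedAddCommGroup H₂]
    [InnerProductSpace ℂ H₂] (x : P →ₗ[ℂ] H₁) (y : P →ₗ[ℂ] H₂) (hxy : ∀ c, ‖y c‖ ≤ ‖x c‖) :
    ∃ (H : Type) (_ : NormedAddCommGroup H) (_ : InnerProductSpace ℂ H) (_ : CompleteSpace H)
      (ι : P →ₗ[ℂ] H), DenseRange ι ∧
        ∀ c c', ⟪ι c, ι c'⟫_ℂ = ⟪x c, x c'⟫_ℂ - ⟪y c, y c'⟫_ℂ := by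
  let core : PreInnerProductSpace.Core ℂ P :=
    { inner := fun c c' => ⟪x c, x c'⟫_ℂ - ⟪y c, y c'⟫_ℂ
      conj_inner_symm := fun c c' => by simp
      re_inner_nonneg := fun c => by
        have h := hxy c
        have : ‖y c‖ ^ 2 ≤ ‖x c‖ ^ 2 := by gcongr
        rw [map_sub, inner_self_eq_norm_sq, inner_self_eq_norm_sq]
        linarith
      add_left := fun a b c => by simp only [map_add, inner_add_left]; ring
      smul_left := fun a b r => by simp only [map_smul, inner_smul_left]; ring }
  -- The form may be degenerate; its null vectors become zero in the separated completion.
  let : SeminormedAddCommGroup P := InnerProductSpace.Core.toSeminormedAddCommGroup (c := core)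
  let : InnerProductSpace ℂ P := InnerProductSpace.ofCore core
  refine ⟨UniformSpace.Completion P, inferInstance, inferInstance, inferInstance,
    (UniformSpace.Completion.toComplL (𝕜 := ℂ) (E := P)).toLinearMap, ?_, ?_⟩
  · exact UniformSpace.Completion.denseRange_coe
  · intro c c'
    exact UniformSpace.Completion.inner_coe c c'

theorem norm_sq_of_inner_eq_sub {P H H₁ H₂ : Type*} [NormedAddCommGroup H] [InnerProductSpace ℂ H]
    [NormedAddCommGroup H₁] [InnerProductSpace ℂ H₁] [NormedAddCommGroup H₂]
    [InnerProductSpace ℂ H₂] {ι : P → H} {x : P → H₁} {y : P → H₂}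
    (h : ∀ c c', ⟪ι c, ι c'⟫_ℂ = ⟪x c, x c'⟫_ℂ - ⟪y c, y c'⟫_ℂ) (c : P) :
    ‖ι c‖ ^ 2 = ‖x c‖ ^ 2 - ‖y c‖ ^ 2 := by
  have h := congrArg Complex.re (h c c)
  rw [Complex.sub_re] at h
  simpa only [inner_self_eq_norm_sq_to_K, ← Complex.ofReal_pow, Complex.coe_algebraMap,
    RCLike.ofReal_eq_complex_ofReal, Complex.ofReal_re] using h

/-! ### Wold decomposition and finite-dimensional models -/

/-- Wold decomposition of a locally nilpotently adjointed isometry which is finitely generated: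
it is a unilateral shift of finite multiplicity. -/
theorem exists_shift_model {P H : Type*} [AddCommGroup P] [Module ℂ P]
    [NormedAddCommGroup H] [InnerProductSpace ℂ H] [CompleteSpace H] (ι : P →ₗ[ℂ] H)
    (hι : DenseRange ι) (Z : P →ₗ[ℂ] P) (hZ : ∀ c, ‖ι (Z c)‖ = ‖ι c‖)
    (hnil : ∀ c, ∃ m, ∀ c', ⟪ι c, ι ((Z ^ m) c')⟫_ℂ = 0) (P₀ : Submodule ℂ P)
    [FiniteDimensional ℂ P₀] (hP₀ : ∀ c, ∃ c₀ ∈ P₀, ∃ c₁, ι c = ι c₀ + ι (Z c₁)) :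
    ∃ (r : ℕ) (A : P →ₗ[ℂ] ell2 (EuclideanSpace ℂ (Fin r))), DenseRange A ∧
      (∀ c, ‖A c‖ = ‖ι c‖) ∧ (∀ c, A (Z c) = ell2.shift 1 (A c)) ∧
      ∀ c m, (∀ c', ⟪ι c, ι ((Z ^ m) c')⟫_ℂ = 0) → ∀ j, m ≤ j → A c j = 0 := by
  -- extend `Z` to an isometry of `H`
  have hker : ∀ c, ‖(ι ∘ₗ Z) c‖ ≤ 1 * ‖ι c‖ := fun c => by simp [hZ]
  let T₀ : H →L[ℂ] H := (ι ∘ₗ Z).extendOfNorm ι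
  have hT₀ : ∀ c, T₀ (ι c) = ι (Z c) := fun c =>
    LinearMap.extendOfNorm_eq hι ⟨1, hker⟩ c
  have hT₀n : ∀ h, ‖T₀ h‖ = ‖h‖ := fun h => by
    refine hι.induction_on (p := fun h => ‖T₀ h‖ = ‖h‖) h ?_ fun c => ?_
    · exact isClosed_eq (by fun_prop) (by fun_prop)
    · rw [hT₀, hZ]
  let T : H →ₗᵢ[ℂ] H := ⟨T₀.toLinearMap, hT₀n⟩
  have hT : ∀ c, T (ι c) = ι (Z c) := hT₀
  have hTpow : ∀ m c, (T ^ m) (ι c) = ι ((Z ^ m) c) := by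
    intro m
    induction m with
    | zero => simp
    | succ m ih =>
      intro c
      rw [pow_succ, pow_succ, LinearIsometry.coe_mul, Function.comp_apply, hT, ih]
      rfl
  let R : Submodule ℂ H := LinearMap.range T.toLinearMap
  have hRc : IsClosed (R : Set H) := by
    have h := T.isometry.isClosedEmbedding.isClosed_range
    rwa [show (R : Set H) = Set.range T from rfl]
  have : CompleteSpace R := hRc.completeSpace_coe
  let E : Submodule ℂ H := Rᗮ
  have hE : ∀ e ∈ E, ∀ h, ⟪e, T h⟫_ℂ = 0 := fun e he h =>
    (Submodule.mem_orthogonal' _ _).1 he _ ⟨h, rfl⟩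
  -- `E` is finite dimensional
  have : FiniteDimensional ℂ E := by
    let F : Submodule ℂ H := P₀.map ι
    have hF : FiniteDimensional ℂ F := inferInstance
    -- Projection to `ι(P₀)` is injective on `E`: by `hP₀`, a vector orthogonal to both `ι(P₀)` and
    -- the range of `T` is orthogonal to the dense range of `ι`.
    let Φ : E →ₗ[ℂ] F := F.orthogonalProjectionOnto.toLinearMap ∘ₗ E.subtype
    refine FiniteDimensional.of_injective Φ ?_
    rw [← LinearMap.ker_eq_bot, LinearMap.ker_eq_bot']
    intro e he
    have h1 : (e : H) ∈ Fᗮ := by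
      rw [← Submodule.orthogonalProjectionOnto_eq_zero_iff]
      exact he
    have h2 : ∀ h : H, ⟪(e : H), h⟫_ℂ = 0 := fun h => by
      refine hι.induction_on (p := fun h => ⟪(e : H), h⟫_ℂ = 0) h ?_ fun c => ?_
      · exact isClosed_eq (by fun_prop) continuous_const
      · obtain ⟨c₀, hc₀, c₁, hc⟩ := hP₀ c
        rw [hc, inner_add_right, ← hT, hE _ e.2, add_zero]
        exact (Submodule.mem_orthogonal' _ _).1 h1 _ ⟨c₀, hc₀, rfl⟩
    exact Subtype.ext (inner_self_eq_zero.1 (h2 e))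
  -- Wold decomposition
  let r := Module.finrank ℂ E
  let b : OrthonormalBasis (Fin r) ℂ E := stdOrthonormalBasis ℂ E
  let V : ∀ i, EuclideanSpace ℂ (Fin r) →ₗᵢ[ℂ] H := fun i =>
    ((T ^ i).comp E.subtypeₗᵢ).comp b.repr.symm.toLinearIsometry
  have hV : ∀ i v, V i v = (T ^ i) (b.repr.symm v : H) := fun i v => rfl
  have hVsucc : ∀ i v, V (i + 1) v = T (V i v) := fun i v => by
    rw [hV, hV, pow_succ']; rfl
  have hpow : ∀ (i : ℕ) (e : E), ∀ h, ⟪(T ^ i) (e : H), (T ^ (i + 1)) h⟫_ℂ = 0 := by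
    intro i e h
    rw [pow_succ, LinearIsometry.coe_mul, Function.comp_apply, LinearIsometry.inner_map_map]
    exact hE _ e.2 _
  have hlt : ∀ i j, i < j → ∀ v w, ⟪V i v, V j w⟫_ℂ = 0 := by
    intro i j hij v w
    obtain ⟨k, rfl⟩ := Nat.exists_eq_add_of_lt hij
    rw [hV, hV, show i + k + 1 = (i + 1) + k by ring, pow_add, LinearIsometry.coe_mul,
      Function.comp_apply]
    exact hpow i _ _
  have hortho : OrthogonalFamily ℂ (fun _ : ℕ => EuclideanSpace ℂ (Fin r)) V := by
    intro i j hij v w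
    rcases lt_or_gt_of_ne hij with h | h
    · exact hlt i j h v w
    · rw [← inner_conj_symm, hlt j i h w v, map_zero]
  have htotal : ⊤ ≤ (⨆ i, LinearMap.range (V i).toLinearMap).topologicalClosure := by
    rw [top_le_iff, Submodule.topologicalClosure_eq_top_iff, Submodule.eq_bot_iff]
    intro x hx
    have hx' : ∀ i v, ⟪V i v, x⟫_ℂ = 0 := fun i v =>
      (Submodule.mem_orthogonal _ _).1 hx _ (Submodule.mem_iSup_of_mem i ⟨v, rfl⟩)
    -- Orthogonality to each `T^i E` peels off one factor `T` at a time, because `Eᗮ` is the closed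
    -- range of `T`.
    have hxpow : ∀ i, ∃ y, x = (T ^ i) y := by
      intro i
      induction i with
      | zero => exact ⟨x, by simp⟩
      | succ i ih =>
        obtain ⟨y, hy⟩ := ih
        have hyE : y ∈ Eᗮ := by
          rw [Submodule.mem_orthogonal]
          intro e he
          have := hx' i (b.repr ⟨e, he⟩)
          rw [hV, hy, LinearIsometry.inner_map_map, LinearIsometryEquiv.symm_apply_apply] at this
          exact this
        rw [Submodule.orthogonal_orthogonal] at hyE
        obtain ⟨z, hz⟩ := hyE
        refine ⟨z, ?_⟩
        rw [hy, pow_succ, LinearIsometry.coe_mul, Function.comp_apply]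
        exact congrArg _ hz.symm
    -- There is no unitary part: `x` lies in every `T^m H`, while each `ι c` is orthogonal to some
    -- `T^m H`.
    have hzero : ∀ h : H, ⟪h, x⟫_ℂ = 0 := fun h => by
      refine hι.induction_on (p := fun h => ⟪h, x⟫_ℂ = 0) h ?_ fun c => ?_
      · exact isClosed_eq (by fun_prop) continuous_const
      · obtain ⟨m, hm⟩ := hnil c
        obtain ⟨y, rfl⟩ := hxpow m
        refine hι.induction_on (p := fun y => ⟪ι c, (T ^ m) y⟫_ℂ = 0) y ?_ fun c' => ?_
        · exact isClosed_eq (continuous_const.inner (T ^ m).continuous) continuous_const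
        · rw [hTpow, hm]
    exact inner_self_eq_zero.1 (hzero x)
  have hsum : IsHilbertSum ℂ (fun _ : ℕ => EuclideanSpace ℂ (Fin r)) V :=
    IsHilbertSum.mk hortho htotal
  let Ψ := hsum.linearIsometryEquiv
  have hcoord : ∀ (h : H) (i : ℕ) (v), ⟪v, Ψ h i⟫_ℂ = ⟪V i v, h⟫_ℂ := by
    intro h i v
    have h1 : ⟪lp.single 2 i v, Ψ h⟫_ℂ = ⟪v, Ψ h i⟫_ℂ := lp.inner_single_left i v (Ψ h)
    have h2 : Ψ.symm (lp.single 2 i v) = V i v := hsum.linearIsometryEquiv_symm_apply_single v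
    rw [← h1, ← h2, ← LinearIsometryEquiv.inner_map_map Ψ, LinearIsometryEquiv.apply_symm_apply]
  refine ⟨r, Ψ.toLinearEquiv.toLinearMap ∘ₗ ι, ?_, ?_, ?_, ?_⟩
  · exact Ψ.surjective.denseRange.comp hι Ψ.continuous
  · intro c
    exact Ψ.norm_map _
  · intro c
    change Ψ (ι (Z c)) = ell2.shift 1 (Ψ (ι c))
    ext i : 2
    rcases i with _ | i
    · rw [ell2.shift_apply_of_lt one_pos]
      refine ext_inner_left ℂ fun v => ?_
      rw [hcoord, ← hT, inner_zero_right, hV]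
      exact hE _ (b.repr.symm v).2 _
    · rw [ell2.shift_apply_add]
      refine ext_inner_left ℂ fun v => ?_
      rw [hcoord, hcoord, ← hT, hVsucc, LinearIsometry.inner_map_map]
  · intro c m hm j hj
    change Ψ (ι c) j = 0
    refine ext_inner_left ℂ fun v => ?_
    rw [hcoord, inner_zero_right, hV]
    generalize (b.repr.symm v : H) = e
    rw [← inner_conj_symm]
    have : ⟪ι c, (T ^ j) e⟫_ℂ = 0 := by
      refine hι.induction_on (p := fun y => ⟪ι c, (T ^ j) y⟫_ℂ = 0) e ?_ fun c' => ?_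
      · exact isClosed_eq (continuous_const.inner (T ^ j).continuous) continuous_const
      · obtain ⟨k, rfl⟩ := Nat.exists_eq_add_of_le hj
        rw [hTpow, pow_add]
        exact hm _
    rw [this, map_zero]

/-- A positive semidefinite form on a finitely generated space is given by a linear map to a
Euclidean space. -/
theorem exists_euclidean_model {P H : Type*} [AddCommGroup P] [Module ℂ P]
    [NormedAddCommGroup H] [InnerProductSpace ℂ H] (ι : P →ₗ[ℂ] H) (P₀ : Submodule ℂ P)
    [FiniteDimensional ℂ P₀] (hP₀ : ∀ c, ∃ c₀ ∈ P₀, ι c = ι c₀) :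
    ∃ (r : ℕ) (G : P →ₗ[ℂ] EuclideanSpace ℂ (Fin r)), ∀ c, ‖G c‖ = ‖ι c‖ := by
  have : FiniteDimensional ℂ (LinearMap.range ι) := by
    have h : LinearMap.range ι = P₀.map ι := by
      refine le_antisymm ?_ LinearMap.map_le_range
      rintro _ ⟨c, rfl⟩
      obtain ⟨c₀, hc₀, hc⟩ := hP₀ c
      exact ⟨c₀, hc₀, hc.symm⟩
    rw [h]
    infer_instance
  refine ⟨_, (stdOrthonormalBasis ℂ (LinearMap.range ι)).repr.toLinearEquiv.toLinearMap ∘ₗ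
    ι.rangeRestrict, fun c => ?_⟩
  exact (stdOrthonormalBasis ℂ (LinearMap.range ι)).repr.norm_map (ι.rangeRestrict c)

/-! ### Polynomials without zeros in the disk or polydisk -/

/-- A polynomial without zeros in the disk which dominates another polynomial on the circle
dominates it in the disk. -/
theorem Polynomial.norm_eval_le_of_circle (C : ℝ) (f g : Polynomial ℂ)
    (hf : ∀ z : ℂ, ‖z‖ < 1 → f.eval z ≠ 0)
    (h : ∀ z : ℂ, ‖z‖ = 1 → ‖g.eval z‖ ≤ C * ‖f.eval z‖) :
    ∀ z : ℂ, ‖z‖ < 1 → ‖g.eval z‖ ≤ C * ‖f.eval z‖ := by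
  induction hn : f.natDegree generalizing f g with
  | zero =>
    by_cases hroot : ∃ a : ℂ, ‖a‖ = 1 ∧ f.eval a = 0
    · obtain ⟨a, -, ha0⟩ := hroot
      rw [Polynomial.eq_C_of_natDegree_eq_zero hn, Polynomial.eval_C] at ha0
      exact absurd (by rw [Polynomial.eq_C_of_natDegree_eq_zero hn, ha0]; simp) (hf 0 (by simp))
    · push Not at hroot
      exact norm_eval_le_aux C f g hf hroot h
  | succ n ih =>
    by_cases hroot : ∃ a : ℂ, ‖a‖ = 1 ∧ f.eval a = 0
    · obtain ⟨a, ha, ha0⟩ := hroot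
      obtain ⟨f₁, rfl⟩ := Polynomial.dvd_iff_isRoot.2 ha0
      -- The bound forces `g` to vanish at each zero of `f` on the circle, so the factor `X - a`
      -- cancels from both.
      have hg0 : g.eval a = 0 := by
        have := h a ha
        rw [ha0, norm_zero, mul_zero] at this
        exact norm_le_zero_iff.1 this
      obtain ⟨g₁, rfl⟩ := Polynomial.dvd_iff_isRoot.2 hg0
      have hf₁ : f₁ ≠ 0 := by
        rintro rfl
        simp at hn
      have hdeg : f₁.natDegree = n := by
        rw [Polynomial.natDegree_mul (Polynomial.X_sub_C_ne_zero a) hf₁,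
          Polynomial.natDegree_X_sub_C] at hn
        omega
      have hne : ∀ z : ℂ, ‖z‖ = 1 → z ≠ a → ‖g₁.eval z‖ ≤ C * ‖f₁.eval z‖ := by
        intro z hz hza
        have h1 := h z hz
        simp only [Polynomial.eval_mul, Polynomial.eval_sub, Polynomial.eval_X,
          Polynomial.eval_C, norm_mul] at h1
        have h2 : 0 < ‖z - a‖ := norm_pos_iff.2 (sub_ne_zero.2 hza)
        rw [mul_left_comm] at h1
        exact le_of_mul_le_mul_left h1 h2
      have hcirc : ∀ z : ℂ, ‖z‖ = 1 → ‖g₁.eval z‖ ≤ C * ‖f₁.eval z‖ := by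
        intro z hz
        by_cases hza : z = a
        · subst hza
          -- At the cancelled root the inequality is the limit along the arc `z exp(it)`, `t → 0+`,
          -- whose points differ from `z`.
          have hcont : Continuous fun t : ℝ => z * Complex.exp (t * Complex.I) := by fun_prop
          have h0 : z * Complex.exp ((0 : ℝ) * Complex.I) = z := by simp
          have hl : Filter.Tendsto (fun t : ℝ => ‖g₁.eval (z * Complex.exp (t * Complex.I))‖)
              (nhdsWithin 0 (Set.Ioi 0)) (nhds ‖g₁.eval z‖) := by
            have := ((g₁.continuous.comp hcont).norm.tendsto 0).mono_left
              (nhdsWithin_le_nhds (s := Set.Ioi 0))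
            simpa using this
          have hr : Filter.Tendsto (fun t : ℝ => C * ‖f₁.eval (z * Complex.exp (t * Complex.I))‖)
              (nhdsWithin 0 (Set.Ioi 0)) (nhds (C * ‖f₁.eval z‖)) := by
            have := (((f₁.continuous.comp hcont).norm.const_mul C).tendsto 0).mono_left
              (nhdsWithin_le_nhds (s := Set.Ioi 0))
            simpa using this
          refine le_of_tendsto_of_tendsto hl hr ?_
          filter_upwards [Ioo_mem_nhdsGT (show (0 : ℝ) < 1 by norm_num)] with t ht
          refine hne _ (by rw [norm_mul, hz, Complex.norm_exp_ofReal_mul_I, one_mul]) ?_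
          intro hEq
          have hz0 : z ≠ 0 := by
            rintro rfl
            simp at hz
          have h1 : Complex.exp (t * Complex.I) = 1 := mul_left_cancel₀ hz0 (by simpa using hEq)
          have h2 := congrArg Complex.im h1
          rw [Complex.exp_ofReal_mul_I_im, Complex.one_im] at h2
          exact (Real.sin_pos_of_pos_of_lt_pi ht.1 (by linarith [ht.2, Real.pi_gt_three])).ne' h2
        · exact hne z hz hza
      intro z hz
      have h3 := ih f₁ g₁ (fun w hw h0 => hf w hw (by simp [h0])) hcirc hdeg z hz
      simp only [Polynomial.eval_mul, norm_mul]
      rw [mul_left_comm]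
      exact mul_le_mul_of_nonneg_left h3 (norm_nonneg _)
    · push Not at hroot
      exact norm_eval_le_aux C f g hf hroot h
where
  -- With no zeros in the closed disk, the maximum principle applies to `g / f`.
  norm_eval_le_aux (C : ℝ) (f g : Polynomial ℂ) (hf : ∀ z : ℂ, ‖z‖ < 1 → f.eval z ≠ 0)
      (hroot : ∀ z : ℂ, ‖z‖ = 1 → f.eval z ≠ 0)
      (h : ∀ z : ℂ, ‖z‖ = 1 → ‖g.eval z‖ ≤ C * ‖f.eval z‖) :
      ∀ z : ℂ, ‖z‖ < 1 → ‖g.eval z‖ ≤ C * ‖f.eval z‖ := by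
    intro z hz
    have hcl : ∀ w ∈ Metric.closedBall (0 : ℂ) 1, f.eval w ≠ 0 := by
      intro w hw
      rcases (mem_closedBall_zero_iff.1 hw).lt_or_eq with h1 | h1
      · exact hf w h1
      · exact hroot w h1
    have hd : DiffContOnCl ℂ (fun w => g.eval w / f.eval w) (Metric.ball 0 1) := by
      refine ⟨fun w hw => ?_, ?_⟩
      · exact (g.differentiable.differentiableAt.div f.differentiable.differentiableAt
          (hcl w (Metric.ball_subset_closedBall hw))).differentiableWithinAt
      · rw [closure_ball _ one_ne_zero]
        exact g.continuous.continuousOn.div f.continuous.continuousOn hcl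
    have := Complex.norm_le_of_forall_mem_frontier_norm_le Metric.isBounded_ball hd (C := C)
      (fun w hw => ?_) (subset_closure (show z ∈ Metric.ball (0 : ℂ) 1 by simpa using hz))
    · rwa [norm_div, div_le_iff₀ (norm_pos_iff.2 (hf z hz))] at this
    · rw [frontier_ball _ one_ne_zero, mem_sphere_zero_iff_norm] at hw
      rw [norm_div, div_le_iff₀ (norm_pos_iff.2 (hroot w hw))]
      exact h w hw

/-- A polynomial without zeros in the closed polydisk is invertible at every tuple of contractions
in a commutative Banach algebra. -/
theorem MvPolynomial.isUnit_aeval {σ A : Type*} [NormedCommRing A] [NormedAlgebra ℂ A]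
    [CompleteSpace A] [NormOneClass A] (p : MvPolynomial σ ℂ)
    (hp : ∀ z : σ → ℂ, (∀ i, ‖z i‖ ≤ 1) → eval z p ≠ 0) (x : σ → A) (hx : ∀ i, ‖x i‖ ≤ 1) :
    IsUnit (aeval x p) := by
  by_contra hu
  have : Nontrivial A := NormOneClass.nontrivial
  -- Gelfand theory: a non-unit is killed by a character. Its values on the `x i` form a point of
  -- the closed polydisk at which `p` would vanish.
  obtain ⟨φ, hφ⟩ := WeakDual.CharacterSpace.exists_apply_eq_zero hu
  let ψ : A →ₐ[ℂ] ℂ := WeakDual.CharacterSpace.toAlgHom φ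
  have hw : ∀ i, ‖ψ (x i)‖ ≤ 1 := fun i =>
    (spectrum.norm_le_norm_of_mem (AlgHom.apply_mem_spectrum ψ (x i))).trans (hx i)
  have h1 : ψ (aeval x p) = 0 := hφ
  have h2 := comp_aeval_apply (R := ℂ) x ψ p
  rw [h1, aeval_eq_eval] at h2
  exact hp (fun i => ψ (x i)) hw h2.symm

/-- Inverting inside the closed subalgebra generated by the `x i`, rather than in `A`, makes the
inverse a limit of polynomials in the `x i`. -/
theorem MvPolynomial.exists_aeval_approx_inverse {σ A : Type*} [NormedCommRing A]
    [NormedAlgebra ℂ A] [CompleteSpace A] [NormOneClass A] (p : MvPolynomial σ ℂ)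
    (hp : ∀ z : σ → ℂ, (∀ i, ‖z i‖ ≤ 1) → eval z p ≠ 0) (x : σ → A) (hx : ∀ i, ‖x i‖ ≤ 1)
    {ε : ℝ} (hε : 0 < ε) : ∃ h : MvPolynomial σ ℂ, ‖1 - aeval x p * aeval x h‖ ≤ ε := by
  let 𝒜 : Subalgebra ℂ A := (aeval (R := ℂ) x).range.topologicalClosure
  have : CompleteSpace 𝒜 := (Subalgebra.isClosed_topologicalClosure _).completeSpace_coe
  have : NormOneClass 𝒜 := ⟨norm_one (α := A)⟩
  let y : σ → 𝒜 := fun i => ⟨x i, Subalgebra.le_topologicalClosure _ ⟨X i, by simp⟩⟩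
  have hy : ∀ q, ((aeval y q : 𝒜) : A) = aeval x q := fun q =>
    comp_aeval_apply (R := ℂ) y 𝒜.val q
  obtain ⟨u, hu⟩ := p.isUnit_aeval hp y hx
  let v : A := ((u⁻¹ : 𝒜ˣ) : 𝒜)
  have hone : aeval x p * v = 1 := by
    have h1 : (u : 𝒜) * (u⁻¹ : 𝒜ˣ) = 1 := u.mul_inv
    rw [hu] at h1
    rw [← hy]
    exact congrArg Subtype.val h1
  have hv : v ∈ closure ((aeval (R := ℂ) x).range : Set A) := ((u⁻¹ : 𝒜ˣ) : 𝒜).2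
  obtain ⟨_, ⟨h, rfl⟩, hh⟩ := Metric.mem_closure_iff.1 hv (ε / (‖aeval x p‖ + 1)) (by positivity)
  refine ⟨h, ?_⟩
  rw [dist_eq_norm] at hh
  rw [← hone, ← mul_sub]
  calc ‖aeval x p * (v - aeval x h)‖ ≤ ‖aeval x p‖ * ‖v - aeval x h‖ := norm_mul_le _ _
    _ ≤ (‖aeval x p‖ + 1) * (ε / (‖aeval x p‖ + 1)) := by
        gcongr
        · linarith
        · exact hh.le
    _ = ε := by field_simp

/-- The inverse of a polynomial without zeros in the closed polydisk is a uniform limit of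
polynomials. -/
theorem MvPolynomial.exists_approx_inverse {σ : Type*} [Finite σ] (p : MvPolynomial σ ℂ)
    (hp : ∀ z : σ → ℂ, (∀ i, ‖z i‖ ≤ 1) → eval z p ≠ 0) {ε : ℝ} (hε : 0 < ε) :
    ∃ h : MvPolynomial σ ℂ, ∀ z : σ → ℂ, (∀ i, ‖z i‖ ≤ 1) → ‖1 - eval z p * eval z h‖ ≤ ε := by
  have := Fintype.ofFinite σ
  let K := Metric.closedBall (0 : σ → ℂ) 1
  have : CompactSpace K := isCompact_iff_compactSpace.1 (isCompact_closedBall _ _)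
  have : Nonempty K := ⟨⟨0, by simp [K]⟩⟩
  have hK : ∀ z : σ → ℂ, (∀ i, ‖z i‖ ≤ 1) ↔ z ∈ K := fun z => by
    rw [mem_closedBall_zero_iff, pi_norm_le_iff_of_nonneg zero_le_one]
  let x : σ → C(K, ℂ) := fun i => ⟨fun z => z.1 i, (continuous_apply i).comp continuous_subtype_val⟩
  have hx : ∀ i, ‖x i‖ ≤ 1 := fun i => by
    rw [ContinuousMap.norm_le _ zero_le_one]
    exact fun z => (hK z.1).2 z.2 i
  have heval : ∀ q (z : K), aeval x q z = eval z.1 q := by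
    intro q z
    induction q using MvPolynomial.induction_on with
    | C a => simp
    | add p q hp hq => simp [hp, hq]
    | mul_X p i hp => simp [hp, x]
  obtain ⟨h, hh⟩ := p.exists_aeval_approx_inverse hp x hx hε
  refine ⟨h, fun z hz => ?_⟩
  have := ((1 - aeval x p * aeval x h).norm_coe_le_norm ⟨z, (hK z).1 hz⟩).trans hh
  simpa [heval] using this

/-! ### Polynomial vectors as double sequences of coefficients -/

open MvPolynomial

/-- The exponent of `z₁ ^ i * z₂ ^ j`. -/
noncomputable def bideg (i j : ℕ) : Fin 2 →₀ ℕ := Finsupp.single 0 i + Finsupp.single 1 j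

@[simp] theorem bideg_apply_zero (i j : ℕ) : bideg i j 0 = i := by simp [bideg]

@[simp] theorem bideg_apply_one (i j : ℕ) : bideg i j 1 = j := by simp [bideg]

theorem bideg_eta (m : Fin 2 →₀ ℕ) : bideg (m 0) (m 1) = m := by
  ext k
  fin_cases k <;> simp

theorem bideg_injective : Function.Injective fun x : ℕ × ℕ => bideg x.1 x.2 := by
  intro x y h
  exact Prod.ext (by simpa using DFunLike.congr_fun h 0) (by simpa using DFunLike.congr_fun h 1)

theorem coeff_X_zero_pow_mul (n i j : ℕ) (q : MvPolynomial (Fin 2) ℂ) :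
    coeff (bideg i j) (X 0 ^ n * q) = if i < n then 0 else coeff (bideg (i - n) j) q := by
  rw [X_pow_eq_monomial, coeff_monomial_mul', one_mul]
  have h1 : Finsupp.single 0 n ≤ bideg i j ↔ n ≤ i := by
    rw [Finsupp.single_le_iff, bideg_apply_zero]
  have h2 : bideg i j - Finsupp.single 0 n = bideg (i - n) j := by
    ext k
    fin_cases k <;> simp
  rw [h2]
  by_cases h : i < n
  · rw [if_neg (by rw [h1]; omega), if_pos h]
  · rw [if_pos (by rw [h1]; omega), if_neg h]

theorem coeff_X_one_pow_mul (n i j : ℕ) (q : MvPolynomial (Fin 2) ℂ) :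
    coeff (bideg i j) (X 1 ^ n * q) = if j < n then 0 else coeff (bideg i (j - n)) q := by
  rw [X_pow_eq_monomial, coeff_monomial_mul', one_mul]
  have h1 : Finsupp.single 1 n ≤ bideg i j ↔ n ≤ j := by
    rw [Finsupp.single_le_iff, bideg_apply_one]
  have h2 : bideg i j - Finsupp.single 1 n = bideg i (j - n) := by
    ext k
    fin_cases k <;> simp
  rw [h2]
  by_cases h : j < n
  · rw [if_neg (by rw [h1]; omega), if_pos h]
  · rw [if_pos (by rw [h1]; omega), if_neg h]

/-- Vectors of polynomials in two variables. -/
abbrev VecPoly (L : ℕ) := Fin L → MvPolynomial (Fin 2) ℂ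

/-- The vector coefficient of `z₁ ^ i * z₂ ^ j`. -/
noncomputable def vcoeff {L : ℕ} (i j : ℕ) : VecPoly L →ₗ[ℂ] EuclideanSpace ℂ (Fin L) where
  toFun c := WithLp.toLp 2 fun k => coeff (bideg i j) (c k)
  map_add' c d := by ext k; simp
  map_smul' a c := by ext k; simp

@[simp] theorem vcoeff_apply {L : ℕ} (i j : ℕ) (c : VecPoly L) (k : Fin L) :
    vcoeff i j c k = coeff (bideg i j) (c k) := rfl

theorem vcoeff_X_zero_pow_smul {L : ℕ} (n i j : ℕ) (c : VecPoly L) :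
    vcoeff i j ((X 0 : MvPolynomial (Fin 2) ℂ) ^ n • c) =
      if i < n then 0 else vcoeff (i - n) j c := by
  ext k
  simp only [vcoeff_apply, Pi.smul_apply, smul_eq_mul, coeff_X_zero_pow_mul]
  split_ifs <;> simp

theorem vcoeff_X_one_pow_smul {L : ℕ} (n i j : ℕ) (c : VecPoly L) :
    vcoeff i j ((X 1 : MvPolynomial (Fin 2) ℂ) ^ n • c) =
      if j < n then 0 else vcoeff i (j - n) c := by
  ext k
  simp only [vcoeff_apply, Pi.smul_apply, smul_eq_mul, coeff_X_one_pow_mul]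
  split_ifs <;> simp

theorem exists_coeff_bound (q : MvPolynomial (Fin 2) ℂ) :
    ∃ D, ∀ i j, D ≤ i ∨ D ≤ j → coeff (bideg i j) q = 0 := by
  refine ⟨q.totalDegree + 1, fun i j h => ?_⟩
  refine coeff_eq_zero_of_totalDegree_lt ?_
  have : ∑ k ∈ (bideg i j).support, bideg i j k = i + j := by
    change (bideg i j).sum (fun _ e => e) = _
    rw [Finsupp.sum_fintype _ _ (fun _ => rfl), Fin.sum_univ_two]
    simp
  omega

theorem exists_coeff_bound_forall {ι : Type*} [Finite ι] (q : ι → MvPolynomial (Fin 2) ℂ) :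
    ∃ D, ∀ k i j, D ≤ i ∨ D ≤ j → coeff (bideg i j) (q k) = 0 := by
  have := Fintype.ofFinite ι
  choose D hD using fun k => exists_coeff_bound (q k)
  refine ⟨Finset.univ.sup D, fun k i j h => hD k i j ?_⟩
  have : D k ≤ Finset.univ.sup D := Finset.le_sup (Finset.mem_univ k)
  omega

theorem exists_vcoeff_bound {L : ℕ} (c : VecPoly L) :
    ∃ D, ∀ i j, D ≤ i ∨ D ≤ j → vcoeff i j c = 0 := by
  obtain ⟨D, hD⟩ := exists_coeff_bound_forall c
  exact ⟨D, fun i j h => by ext k; exact hD k i j h⟩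

/-- The coefficient of `z₂ ^ j`, as the sequence of its coefficients. -/
noncomputable def toRow {L : ℕ} (j : ℕ) : VecPoly L →ₗ[ℂ] ell2 (EuclideanSpace ℂ (Fin L)) where
  toFun c := ell2.ofFinite (fun i => vcoeff i j c) <| by
    obtain ⟨D, hD⟩ := exists_vcoeff_bound c
    refine (Set.finite_lt_nat D).subset fun i hi => ?_
    by_contra h
    exact hi (hD i j (Or.inl (not_lt.1 h)))
  map_add' c d := by
    ext i : 2
    exact map_add (vcoeff i j) c d
  map_smul' a c := by
    ext i : 2
    exact map_smul (vcoeff i j) a c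

@[simp] theorem toRow_apply {L : ℕ} (i j : ℕ) (c : VecPoly L) : toRow j c i = vcoeff i j c := rfl

/-- The double sequence of coefficients of a vector of polynomials. -/
noncomputable def toSeq {L : ℕ} :
    VecPoly L →ₗ[ℂ] ell2 (ell2 (EuclideanSpace ℂ (Fin L))) where
  toFun c := ell2.ofFinite (fun j => toRow j c) <| by
    obtain ⟨D, hD⟩ := exists_vcoeff_bound c
    refine (Set.finite_lt_nat D).subset fun j hj => ?_
    by_contra h
    refine hj ?_
    ext i : 2
    exact hD i j (Or.inr (not_lt.1 h))
  map_add' c d := by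
    ext j : 2
    exact map_add (toRow j) c d
  map_smul' a c := by
    ext j : 2
    exact map_smul (toRow j) a c

@[simp] theorem toSeq_apply {L : ℕ} (j : ℕ) (c : VecPoly L) : toSeq c j = toRow j c := rfl

theorem toRow_X_zero_pow_smul {L : ℕ} (n j : ℕ) (c : VecPoly L) :
    toRow j ((X 0 : MvPolynomial (Fin 2) ℂ) ^ n • c) = ell2.shift n (toRow j c) := by
  ext i : 2
  rw [toRow_apply, vcoeff_X_zero_pow_smul, ell2.shift_apply, toRow_apply]

theorem toSeq_X_one_pow_smul {L : ℕ} (n : ℕ) (c : VecPoly L) :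
    toSeq ((X 1 : MvPolynomial (Fin 2) ℂ) ^ n • c) = ell2.shift n (toSeq c) := by
  ext j i : 4
  rw [toSeq_apply, toRow_apply, vcoeff_X_one_pow_smul, ell2.shift_apply, toSeq_apply]
  split_ifs <;> simp

theorem norm_toSeq_sq {L D : ℕ} (c : VecPoly L)
    (hD : ∀ i j, D ≤ i ∨ D ≤ j → vcoeff i j c = 0) :
    ‖toSeq c‖ ^ 2 = ∑ j ∈ Finset.range D, ∑ i ∈ Finset.range D, ‖vcoeff i j c‖ ^ 2 := by
  rw [ell2.norm_sq_eq_sum (n := D)]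
  · refine Finset.sum_congr rfl fun j _ => ?_
    rw [toSeq_apply, ell2.norm_sq_eq_sum (n := D)]
    · rfl
    · exact fun i hi => hD i j (Or.inl hi)
  · intro j hj
    ext i : 2
    exact hD i j (Or.inr hj)

/-! ### Parseval's identity on the torus -/

/-- The normalized Haar measure of the torus. -/
noncomputable def torusMeasure : MeasureTheory.Measure (UnitAddTorus (Fin 2)) :=
  MeasureTheory.Measure.pi fun _ => AddCircle.haarAddCircle

instance : MeasureTheory.IsProbabilityMeasure torusMeasure :=
  inferInstanceAs (MeasureTheory.IsProbabilityMeasure (MeasureTheory.Measure.pi fun _ => _))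

/-- The parametrization of the torus `𝕋²` by `(ℝ / ℤ)²`. -/
noncomputable def torusPoint (x : UnitAddTorus (Fin 2)) : Fin 2 → ℂ := fun k => fourier 1 (x k)

theorem continuous_torusPoint : Continuous torusPoint :=
  continuous_pi fun k => (fourier 1).continuous.comp (continuous_apply k)

theorem norm_torusPoint (x : UnitAddTorus (Fin 2)) (k : Fin 2) : ‖torusPoint x k‖ = 1 := by
  simp only [torusPoint, fourier_one, Circle.norm_coe]

theorem continuous_eval_torusPoint (q : MvPolynomial (Fin 2) ℂ) :
    Continuous fun x => eval (torusPoint x) q :=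
  (MvPolynomial.continuous_eval q).comp continuous_torusPoint

theorem eval_torusPoint_eq (q : MvPolynomial (Fin 2) ℂ) (x : UnitAddTorus (Fin 2)) :
    eval (torusPoint x) q =
      ∑ m ∈ q.support, coeff m q * UnitAddTorus.mFourier (fun k => (m k : ℤ)) x := by
  rw [eval_eq']
  refine Finset.sum_congr rfl fun m _ => ?_
  congr 1
  simp [torusPoint, UnitAddTorus.mFourier, fourier_apply, AddCircle.toCircle_nsmul]

/-- On the torus distinct monomials are distinct characters, hence orthonormal. -/
theorem integral_norm_eval_sq (q : MvPolynomial (Fin 2) ℂ) :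
    ∫ x, ‖eval (torusPoint x) q‖ ^ 2 ∂torusMeasure = ∑ m ∈ q.support, ‖coeff m q‖ ^ 2 := by
  let e : (Fin 2 →₀ ℕ) → Fin 2 → ℤ := fun m k => (m k : ℤ)
  have he : Function.Injective e := fun m n h => by
    ext k
    exact Nat.cast_injective (R := ℤ) (congrFun h k)
  let f : C(UnitAddTorus (Fin 2), ℂ) :=
    ∑ m ∈ q.support, coeff m q • UnitAddTorus.mFourier (e m)
  have hf : ∀ x, f x = eval (torusPoint x) q := fun x => by
    simp [f, eval_torusPoint_eq, e]
  have hortho : Orthonormal ℂ fun n : Fin 2 → ℤ =>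
      ContinuousMap.toLp (E := ℂ) 2 torusMeasure ℂ (UnitAddTorus.mFourier n) :=
    UnitAddTorus.orthonormal_mFourier
  have h1 := MeasureTheory.ContinuousMap.inner_toLp (𝕜 := ℂ) torusMeasure f f
  have h2 : ContinuousMap.toLp (E := ℂ) 2 torusMeasure ℂ f =
      ∑ m ∈ q.support, coeff m q • ((fun n : Fin 2 → ℤ =>
        ContinuousMap.toLp (E := ℂ) 2 torusMeasure ℂ (UnitAddTorus.mFourier n)) ∘ e) m := by
    simp [f, map_sum, map_smul]
  rw [h2, (hortho.comp e he).inner_sum] at h1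
  have h3 : ∀ a : ℂ, a * (starRingEnd ℂ) a = ((‖a‖ ^ 2 : ℝ) : ℂ) := fun a => by
    rw [Complex.mul_conj, Complex.normSq_eq_norm_sq]
  have h4 : ∀ a : ℂ, (starRingEnd ℂ) a * a = ((‖a‖ ^ 2 : ℝ) : ℂ) := fun a => by
    rw [mul_comm, h3]
  simp only [h3, h4, hf] at h1
  rw [integral_complex_ofReal, ← Complex.ofReal_sum] at h1
  exact (Complex.ofReal_injective h1).symm

theorem norm_toSeq_sq_eq_integral {L : ℕ} (c : VecPoly L) :
    ‖toSeq c‖ ^ 2 = ∫ x, ∑ k, ‖eval (torusPoint x) (c k)‖ ^ 2 ∂torusMeasure := by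
  obtain ⟨D, hD⟩ := exists_coeff_bound_forall c
  have hD' : ∀ i j, D ≤ i ∨ D ≤ j → vcoeff i j c = 0 := fun i j h => by
    ext k
    exact hD k i j h
  have hint : ∀ k ∈ Finset.univ, MeasureTheory.Integrable
      (fun x => ‖eval (torusPoint x) (c k)‖ ^ 2) torusMeasure := fun k _ =>
    ((continuous_eval_torusPoint (c k)).norm.pow 2).integrable_of_hasCompactSupport
      (HasCompactSupport.of_compactSpace _)
  rw [MeasureTheory.integral_finsetSum _ hint, norm_toSeq_sq c hD', ← Finset.sum_product']
  simp only [integral_norm_eval_sq, EuclideanSpace.norm_sq_eq]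
  rw [Finset.sum_comm]
  refine Finset.sum_congr rfl fun k _ => ?_
  symm
  refine Finset.sum_bij_ne_zero (fun m _ _ => (m 1, m 0)) ?_ ?_ ?_ ?_
  · intro m _ hm
    rw [Finset.mem_product, Finset.mem_range, Finset.mem_range]
    by_contra h
    apply hm
    have := hD k (m 0) (m 1) (by simp only at h; omega)
    rw [bideg_eta] at this
    simp [this]
  · intro m _ _ n _ _ h
    rw [Prod.mk.injEq] at h
    rw [← bideg_eta m, ← bideg_eta n, h.1, h.2]
  · rintro ⟨j, i⟩ _ h
    have h' : coeff (bideg i j) (c k) ≠ 0 := by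
      rintro h0
      simp [h0] at h
    exact ⟨bideg i j, by simpa [mem_support_iff] using h', by simpa using h', by simp⟩
  · intro m _ _
    simp [bideg_eta]

theorem torusPoint_mem (x : UnitAddTorus (Fin 2)) : torusPoint x ∈ bitorus :=
  ⟨norm_torusPoint x 0, norm_torusPoint x 1⟩

theorem eval_mulVec {M N : ℕ} (z : Fin 2 → ℂ)
    (Q : Matrix (Fin M) (Fin N) (MvPolynomial (Fin 2) ℂ)) (c : VecPoly N) (k : Fin M) :
    eval z (Q.mulVec c k) = (evalMatrix z Q).mulVec (fun l => eval z (c l)) k := by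
  simp [evalMatrix, Matrix.mulVec, dotProduct]

/-- Through Parseval, pointwise domination on the torus becomes domination of coefficient norms. -/
theorem norm_toSeq_le {L L' : ℕ} (C : ℝ) (hC : 0 ≤ C) (c : VecPoly L) (d : VecPoly L')
    (h : ∀ z ∈ bitorus, ∑ k, ‖eval z (d k)‖ ^ 2 ≤ C ^ 2 * ∑ k, ‖eval z (c k)‖ ^ 2) :
    ‖toSeq d‖ ≤ C * ‖toSeq c‖ := by
  have hint : ∀ {K : ℕ} (e : VecPoly K), MeasureTheory.Integrable
      (fun x => ∑ k, ‖eval (torusPoint x) (e k)‖ ^ 2) torusMeasure := fun e =>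
    (continuous_finsetSum _ fun k _ =>
      (continuous_eval_torusPoint (e k)).norm.pow 2).integrable_of_hasCompactSupport
        (HasCompactSupport.of_compactSpace _)
  rw [← sq_le_sq₀ (norm_nonneg _) (by positivity), mul_pow, norm_toSeq_sq_eq_integral,
    norm_toSeq_sq_eq_integral, ← MeasureTheory.integral_const_mul]
  exact MeasureTheory.integral_mono (hint d) ((hint c).const_mul _) fun x => h _ (torusPoint_mem x)

/-! ### Dilations and contractivity of truncated multiplication -/

/-- The dilation `z ↦ q (r z)` of a polynomial `q`. -/
noncomputable def dilate (r : ℝ) : MvPolynomial (Fin 2) ℂ →ₐ[ℂ] MvPolynomial (Fin 2) ℂ :=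
  aeval fun i => C (r : ℂ) * X i

theorem eval_dilate (r : ℝ) (z : Fin 2 → ℂ) (q : MvPolynomial (Fin 2) ℂ) :
    eval z (dilate r q) = eval (fun i => (r : ℂ) * z i) q := by
  induction q using MvPolynomial.induction_on with
  | C a => simp [dilate]
  | add p q hp hq => simp [hp, hq]
  | mul_X p i hp => simp [hp]; simp [dilate]

theorem dilate_one (q : MvPolynomial (Fin 2) ℂ) : dilate 1 q = q := by
  simp [dilate]

/-- The vector is a polynomial in `r` with coefficients in `VecPoly L`, so `T` needs no continuity.
This allows `r → 1` in the truncated inequality. -/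
theorem continuous_dilate_smul {L : ℕ} {H : Type*} [NormedAddCommGroup H] [NormedSpace ℂ H]
    (T : VecPoly L →ₗ[ℂ] H) (q : MvPolynomial (Fin 2) ℂ) (c : VecPoly L) :
    Continuous fun r : ℝ => T (dilate r q • c) := by
  induction q using MvPolynomial.induction_on generalizing c with
  | C a =>
    have : ∀ r, dilate r (C a) = C a := fun r => by simp [dilate]
    simp only [this]
    exact continuous_const
  | add p q hp hq =>
    simp only [map_add, add_smul]
    exact (hp c).add (hq c)
  | mul_X p i hp =>
    have : ∀ r : ℝ, T (dilate r (p * X i) • c) =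
        (r : ℂ) • T (dilate r p • ((X i : MvPolynomial (Fin 2) ℂ) • c)) := fun r => by
      rw [← map_smul]
      congr 1
      ext1 k
      simp [dilate, mul_assoc, smul_eq_C_mul, mul_left_comm]
    simp only [this]
    exact Complex.continuous_ofReal.smul (hp _)

theorem continuous_dilate_mulVec {M N : ℕ} {H : Type*} [NormedAddCommGroup H] [NormedSpace ℂ H]
    (T : VecPoly M →ₗ[ℂ] H) (Q : Matrix (Fin M) (Fin N) (MvPolynomial (Fin 2) ℂ))
    (c : VecPoly N) : Continuous fun r : ℝ => T ((Q.map (dilate r)).mulVec c) := by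
  have : ∀ r : ℝ, (Q.map (dilate r)).mulVec c =
      ∑ k, ∑ l, dilate r (Q k l) • Pi.single k (c l) := fun r => by
    ext1 k
    simp [Matrix.mulVec, dotProduct, Finset.sum_apply, Pi.single_apply]
  simp only [this, map_sum]
  exact continuous_finsetSum _ fun k _ => continuous_finsetSum _ fun l _ =>
    continuous_dilate_smul T _ _

theorem toSeq_monomial {L : ℕ} (i j : ℕ) (e : EuclideanSpace ℂ (Fin L)) :
    toSeq (fun k => monomial (bideg i j) (e k)) = lp.single 2 j (lp.single 2 i e) := by
  have hne : ∀ {i' j'}, (i', j') ≠ (i, j) → bideg i j ≠ bideg i' j' := fun h h' =>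
    h (bideg_injective h'.symm)
  ext j' i' k
  change coeff (bideg i' j') (monomial (bideg i j) (e k)) = _
  by_cases hj : j' = j
  · subst hj
    rw [lp.single_apply_self]
    by_cases hi : i' = i
    · subst hi
      rw [lp.single_apply_self, coeff_monomial, if_pos rfl]
    · rw [lp.single_apply_ne _ _ _ hi, coeff_monomial, if_neg (hne (by simp [hi]))]
      rfl
  · rw [lp.single_apply_ne _ _ _ hj, coeff_monomial, if_neg (hne (by simp [hj]))]
    rfl

/-- Multiplication of polynomial vectors by a polynomial. -/
noncomputable def polyMul {L : ℕ} (q : MvPolynomial (Fin 2) ℂ) : VecPoly L →ₗ[ℂ] VecPoly L :=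
  (LinearMap.lsmul (MvPolynomial (Fin 2) ℂ) (VecPoly L) q).restrictScalars ℂ

@[simp] theorem polyMul_apply {L : ℕ} (q : MvPolynomial (Fin 2) ℂ) (c : VecPoly L) :
    polyMul q c = q • c := rfl

/-- Multiplication of polynomial vectors by a polynomial matrix. -/
noncomputable def matMul {M N : ℕ} (Q : Matrix (Fin M) (Fin N) (MvPolynomial (Fin 2) ℂ)) :
    VecPoly N →ₗ[ℂ] VecPoly M :=
  Q.mulVecLin.restrictScalars ℂ

@[simp] theorem matMul_apply {M N : ℕ} (Q : Matrix (Fin M) (Fin N) (MvPolynomial (Fin 2) ℂ))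
    (c : VecPoly N) : matMul Q c = Q.mulVec c := rfl

/-- Multiplication by a polynomial without zeros in the closed bidisk has dense range. -/
theorem denseRange_toSeq_polyMul {L : ℕ} (p : MvPolynomial (Fin 2) ℂ)
    (hp : ∀ z : Fin 2 → ℂ, (∀ i, ‖z i‖ ≤ 1) → eval z p ≠ 0) :
    DenseRange (toSeq ∘ₗ polyMul p : VecPoly L →ₗ[ℂ] _) := by
  let W := (LinearMap.range (toSeq ∘ₗ polyMul p :
    VecPoly L →ₗ[ℂ] ell2 (ell2 (EuclideanSpace ℂ (Fin L))))).topologicalClosure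
  have hW : IsClosed (W : Set (ell2 (ell2 (EuclideanSpace ℂ (Fin L))))) :=
    Submodule.isClosed_topologicalClosure _
  have hmem : ∀ c : VecPoly L, toSeq c ∈ W := by
    intro c
    refine Metric.mem_closure_iff.2 fun ε hε => ?_
    have hδ : 0 < ε / (‖toSeq c‖ + 1) := by positivity
    -- Since `h` is uniformly close to `1 / p`, the vector `p h c` is close to `c` in mean square on
    -- the torus.
    obtain ⟨h, hh⟩ := p.exists_approx_inverse hp hδ
    refine ⟨_, ⟨h • c, rfl⟩, ?_⟩
    rw [LinearMap.comp_apply, dist_eq_norm, ← map_sub]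
    refine (norm_toSeq_le _ hδ.le c _ fun z hz => ?_).trans_lt ?_
    · rw [Finset.mul_sum]
      refine Finset.sum_le_sum fun k _ => ?_
      have h1 : eval z ((c - polyMul p (h • c)) k) =
          (1 - eval z p * eval z h) * eval z (c k) := by
        simp
        ring
      rw [h1, norm_mul, mul_pow]
      have h2 := hh z fun i => by
        fin_cases i
        · exact hz.1.le
        · exact hz.2.le
      gcongr
    · rw [div_mul_eq_mul_div, div_lt_iff₀ (by positivity)]
      nlinarith [norm_nonneg (toSeq c)]
  intro f
  refine ell2.mem_of_forall_single (W := W) hW (fun j v => ?_) f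
  let S := lp.singleContinuousLinearMap ℂ (fun _ : ℕ => ell2 (EuclideanSpace ℂ (Fin L))) 2 j
  refine ell2.mem_of_forall_single (W := W.comap S.toLinearMap) (hW.preimage S.continuous)
    (fun i e => ?_) v
  change lp.single 2 j (lp.single 2 i e) ∈ W
  rw [← toSeq_monomial]
  exact hmem _

/-- Contractivity is inherited by dilations. -/
theorem norm_eval_dilate_le {M N : ℕ} (Q : Matrix (Fin M) (Fin N) (MvPolynomial (Fin 2) ℂ))
    (p : MvPolynomial (Fin 2) ℂ) (hp : ∀ z ∈ bidisk, eval z p ≠ 0)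
    (hT : ∀ z ∈ bitorus, ∀ v : Fin N → ℂ,
      ∑ k, ‖(evalMatrix z Q).mulVec v k‖ ^ 2 = ‖eval z p‖ ^ 2 * ∑ k, ‖v k‖ ^ 2)
    {r : ℝ} (hr0 : 0 ≤ r) (hr1 : r < 1) (z : Fin 2 → ℂ) (hz : z ∈ bitorus) (v : Fin N → ℂ) :
    ∑ k, ‖(evalMatrix (fun i => (r : ℂ) * z i) Q).mulVec v k‖ ^ 2 ≤
      ‖eval (fun i => (r : ℂ) * z i) p‖ ^ 2 * ∑ k, ‖v k‖ ^ 2 := by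
  -- Restriction to the disc `t ↦ t z` reduces the estimate to one variable.
  let ρ : MvPolynomial (Fin 2) ℂ →+* Polynomial ℂ :=
    (aeval fun i => Polynomial.X * Polynomial.C (z i) :
      MvPolynomial (Fin 2) ℂ →ₐ[ℂ] Polynomial ℂ).toRingHom
  have hρ : ∀ q (t : ℂ), (ρ q).eval t = eval (fun i => t * z i) q := by
    intro q t
    induction q using MvPolynomial.induction_on with
    | C a => simp [ρ]
    | add p q hp hq => simp [hp, hq]
    | mul_X p i hp => simp [hp]; simp [ρ, mul_comm (z i)]
  have hin : ∀ t : ℂ, ‖t‖ < 1 → (fun i => t * z i) ∈ bidisk := fun t ht =>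
    ⟨by simpa [hz.1] using ht, by simpa [hz.2] using ht⟩
  have hon : ∀ t : ℂ, ‖t‖ = 1 → (fun i => t * z i) ∈ bitorus := fun t ht =>
    ⟨by simpa [hz.1] using ht, by simpa [hz.2] using ht⟩
  have hrn : ‖(r : ℂ)‖ < 1 := by rwa [Complex.norm_real, Real.norm_of_nonneg hr0]
  set w : Fin 2 → ℂ := fun i => (r : ℂ) * z i with hw
  let V : EuclideanSpace ℂ (Fin N) := WithLp.toLp 2 v
  let a : EuclideanSpace ℂ (Fin M) := WithLp.toLp 2 ((evalMatrix w Q).mulVec v)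
  have hV : ‖V‖ ^ 2 = ∑ k, ‖v k‖ ^ 2 := EuclideanSpace.norm_sq_eq _
  have ha : ‖a‖ ^ 2 = ∑ k, ‖(evalMatrix w Q).mulVec v k‖ ^ 2 := EuclideanSpace.norm_sq_eq _
  -- Pairing with the fixed vector `a` makes the function scalar; its value at `t = r` is `‖a‖²`.
  let g : Polynomial ℂ := ∑ k, Polynomial.C (star (a k)) * ∑ l, ρ (Q k l) * Polynomial.C (v l)
  have hg : ∀ t : ℂ, g.eval t = inner ℂ a
      (WithLp.toLp 2 ((evalMatrix (fun i => t * z i) Q).mulVec v)) := by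
    intro t
    simp only [g, Polynomial.eval_finsetSum, Polynomial.eval_mul, Polynomial.eval_C, hρ,
      PiLp.inner_apply, evalMatrix, Matrix.mulVec, dotProduct, Matrix.map_apply]
    refine Finset.sum_congr rfl fun k _ => ?_
    rw [RCLike.inner_apply, mul_comm]
    rfl
  have key := Polynomial.norm_eval_le_of_circle (‖a‖ * ‖V‖) (ρ p) g
    (fun t ht => by rw [hρ]; exact hp _ (hin t ht)) (fun t ht => by
      rw [hg, hρ]
      refine (norm_inner_le_norm _ _).trans ?_
      rw [mul_assoc]
      refine mul_le_mul_of_nonneg_left ?_ (norm_nonneg _)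
      rw [← sq_le_sq₀ (norm_nonneg _) (by positivity), mul_pow, hV, mul_comm (∑ k, ‖v k‖ ^ 2),
        ← hT _ (hon t ht), EuclideanSpace.norm_sq_eq]) r hrn
  rw [hg, hρ] at key
  change ‖inner ℂ a a‖ ≤ _ at key
  rw [inner_self_eq_norm_sq_to_K] at key
  have key' : ‖a‖ * ‖a‖ ≤ ‖a‖ * (‖V‖ * ‖eval w p‖) := by
    have : ‖((‖a‖ : ℂ)) ^ 2‖ = ‖a‖ * ‖a‖ := by simp [sq]
    rw [← this, ← mul_assoc]
    exact key
  rw [← ha, ← hV, ← mul_pow]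
  rcases (norm_nonneg a).eq_or_lt with h0 | h0
  · rw [← h0, zero_pow two_ne_zero]
    positivity
  · have := le_of_mul_le_mul_left key' h0
    rw [mul_comm (‖eval w p‖)]
    gcongr

/-- Truncated Toeplitz contractivity of a rational contractive function. -/
theorem norm_head_toSeq_le {M N : ℕ} (Q : Matrix (Fin M) (Fin N) (MvPolynomial (Fin 2) ℂ))
    (p : MvPolynomial (Fin 2) ℂ) (hp : ∀ z ∈ bidisk, eval z p ≠ 0)
    (hT : ∀ z ∈ bitorus, ∀ v : Fin N → ℂ,
      ∑ k, ‖(evalMatrix z Q).mulVec v k‖ ^ 2 = ‖eval z p‖ ^ 2 * ∑ k, ‖v k‖ ^ 2)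
    (n : ℕ) (c : VecPoly N) :
    ‖ell2.head n (toSeq (Q.mulVec c))‖ ≤ ‖ell2.head n (toSeq (p • c))‖ := by
  -- `p` may vanish on the torus. For `r < 1` the dilated `p` has no zeros in the closed bidisk, so
  -- multiplication by it has dense range.
  have hr : ∀ r ∈ Set.Ico (0 : ℝ) 1, ‖ell2.head n (toSeq ((Q.map (dilate r)).mulVec c))‖ ≤
      ‖ell2.head n (toSeq (dilate r p • c))‖ := by
    rintro r ⟨hr0, hr1⟩
    refine norm_head_le_of_contraction (toSeq ∘ₗ polyMul (dilate r p))
      (toSeq ∘ₗ matMul (Q.map (dilate r))) ?_ ?_ n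
      (polyMul ((X 1 : MvPolynomial (Fin 2) ℂ) ^ n)) ?_ ?_ c
    · intro c
      rw [← one_mul ‖(toSeq ∘ₗ polyMul (dilate r p)) c‖]
      refine norm_toSeq_le 1 zero_le_one _ _ fun z hz => ?_
      rw [one_pow, one_mul]
      have h := norm_eval_dilate_le Q p hp hT hr0 hr1 z hz fun l => eval z (c l)
      have hQ : evalMatrix z (Q.map (dilate r)) = evalMatrix (fun i => (r : ℂ) * z i) Q := by
        ext k l
        simp [evalMatrix, eval_dilate]
      simp only [matMul_apply, eval_mulVec, hQ, polyMul_apply, Pi.smul_apply, smul_eq_mul,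
        map_mul, eval_dilate, norm_mul, mul_pow, ← Finset.mul_sum]
      exact h
    · refine denseRange_toSeq_polyMul _ fun z hz => ?_
      rw [eval_dilate]
      have : ∀ i, ‖(r : ℂ) * z i‖ < 1 := fun i => by
        rw [norm_mul, Complex.norm_real, Real.norm_of_nonneg hr0]
        exact (mul_le_of_le_one_right hr0 (hz i)).trans_lt hr1
      exact hp _ ⟨this 0, this 1⟩
    · intro c
      simp only [LinearMap.comp_apply, polyMul_apply]
      rw [smul_comm, toSeq_X_one_pow_smul]
    · intro c
      simp only [LinearMap.comp_apply, polyMul_apply, matMul_apply]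
      rw [Matrix.mulVec_smul, toSeq_X_one_pow_smul]
  have hsum : ∀ {L : ℕ} (d : VecPoly L), ‖ell2.head n (toSeq d)‖ ^ 2 =
      ∑ j ∈ Finset.range n, ‖toRow j d‖ ^ 2 := fun d => ell2.norm_head_sq _ _
  -- Only finitely many rows enter, each continuous in `r`, so the inequality survives at `r = 1`.
  have hcl : IsClosed {r : ℝ | ∑ j ∈ Finset.range n, ‖toRow j ((Q.map (dilate r)).mulVec c)‖ ^ 2 ≤
      ∑ j ∈ Finset.range n, ‖toRow j (dilate r p • c)‖ ^ 2} :=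
    isClosed_le
      (continuous_finsetSum _ fun j _ => (continuous_dilate_mulVec (toRow j) Q c).norm.pow 2)
      (continuous_finsetSum _ fun j _ => (continuous_dilate_smul (toRow j) p c).norm.pow 2)
  have h1 : (1 : ℝ) ∈ {r : ℝ | ∑ j ∈ Finset.range n,
      ‖toRow j ((Q.map (dilate r)).mulVec c)‖ ^ 2 ≤
      ∑ j ∈ Finset.range n, ‖toRow j (dilate r p • c)‖ ^ 2} := by
    refine closure_minimal (s := Set.Ico (0 : ℝ) 1) (fun r hr' => ?_) hcl ?_
    · rw [Set.mem_ofPred_eq, ← hsum, ← hsum]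
      have := hr r hr'
      gcongr
    · rw [closure_Ico zero_ne_one]
      exact ⟨zero_le_one, le_rfl⟩
  rw [← sq_le_sq₀ (norm_nonneg _) (norm_nonneg _), hsum, hsum]
  have hQ : Q.map (dilate 1) = Q := by
    ext1 k l
    simp [dilate_one]
  simpa [hQ, dilate_one] using h1

/-- This is why a defect vanishes whenever the truncation cuts nothing off. -/
theorem norm_toSeq_mulVec_eq {M N : ℕ} (Q : Matrix (Fin M) (Fin N) (MvPolynomial (Fin 2) ℂ))
    (p : MvPolynomial (Fin 2) ℂ)
    (hT : ∀ z ∈ bitorus, ∀ v : Fin N → ℂ,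
      ∑ k, ‖(evalMatrix z Q).mulVec v k‖ ^ 2 = ‖eval z p‖ ^ 2 * ∑ k, ‖v k‖ ^ 2)
    (c : VecPoly N) : ‖toSeq (Q.mulVec c)‖ = ‖toSeq (p • c)‖ := by
  have h : ∀ z ∈ bitorus, ∑ k, ‖eval z (Q.mulVec c k)‖ ^ 2 = ∑ k, ‖eval z ((p • c) k)‖ ^ 2 := by
    intro z hz
    simp only [eval_mulVec, Pi.smul_apply, smul_eq_mul, map_mul, norm_mul, mul_pow,
      ← Finset.mul_sum]
    exact hT z hz _
  refine le_antisymm ?_ ?_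
  · rw [← one_mul ‖toSeq (p • c)‖]
    exact norm_toSeq_le 1 zero_le_one _ _ fun z hz => by rw [h z hz, one_pow, one_mul]
  · rw [← one_mul ‖toSeq (Q.mulVec c)‖]
    exact norm_toSeq_le 1 zero_le_one _ _ fun z hz => by rw [h z hz, one_pow, one_mul]

/-! ### Backward shifts, degree bounds and density -/

namespace ell2

variable {V : Type*} [NormedAddCommGroup V] [InnerProductSpace ℂ V]

/-- The backward shift has no eigenvalues outside the open disk. -/
theorem eq_zero_of_drop_eq_smul {b : ℂ} (hb : 1 ≤ ‖b‖) {g : ell2 V} (hg : drop 1 g = b • g) :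
    g = 0 := by
  have hstep : ∀ i, g (i + 1) = b • g i := fun i => by
    have := congrArg (fun f : ell2 V => f i) hg
    simpa using this
  have hpow : ∀ i, g i = b ^ i • g 0 := fun i => by
    induction i with
    | zero => simp
    | succ i ih => rw [hstep, ih, smul_smul, pow_succ']
  have hle : ∀ i, ‖g 0‖ ^ 2 ≤ ‖g i‖ ^ 2 := fun i => by
    have : ‖g 0‖ ≤ ‖g i‖ := by
      rw [hpow i, norm_smul, norm_pow]
      exact le_mul_of_one_le_left (norm_nonneg _) (one_le_pow₀ hb)
    gcongr
  have h0 : ‖g 0‖ ^ 2 ≤ 0 :=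
    ge_of_tendsto' (summable_norm_sq g).tendsto_atTop_zero hle
  have h1 : g 0 = 0 := by
    rw [← norm_eq_zero]
    nlinarith [norm_nonneg (g 0)]
  ext i
  rw [hpow i, h1, smul_zero]
  rfl

theorem drop_pow_apply (l : ℕ) (g : ell2 V) (i : ℕ) :
    (((drop 1 : Module.End ℂ (ell2 V)) ^ l) g) i = g (i + l) := by
  induction l generalizing i with
  | zero => simp
  | succ l ih =>
    rw [pow_succ', Module.End.mul_apply, drop_apply, ih, add_assoc, add_comm 1 l]

/-- All roots `b` of `q` satisfy `1 ≤ ‖b‖`, so each linear factor is injective at the backward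
shift. -/
theorem eq_zero_of_aeval_drop_eq_zero (q : Polynomial ℂ) (hq0 : q ≠ 0)
    (hq : ∀ b : ℂ, ‖b‖ < 1 → q.eval b ≠ 0) (g : ell2 V)
    (hg : Polynomial.aeval (drop 1 : Module.End ℂ (ell2 V)) q g = 0) : g = 0 := by
  induction hn : q.natDegree generalizing q with
  | zero =>
    rw [Polynomial.eq_C_of_natDegree_eq_zero hn] at hg hq0
    rw [Polynomial.aeval_C, Module.algebraMap_end_apply] at hg
    exact (smul_eq_zero.1 hg).resolve_left fun h => hq0 (by rw [h, Polynomial.C_0])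
  | succ n ih =>
    obtain ⟨b, hb⟩ := IsAlgClosed.exists_root q (by
      rw [Polynomial.degree_eq_natDegree hq0, hn]
      exact_mod_cast n.succ_ne_zero)
    obtain ⟨q₁, rfl⟩ := Polynomial.dvd_iff_isRoot.2 hb
    have hq₁ : q₁ ≠ 0 := right_ne_zero_of_mul hq0
    have hdeg : q₁.natDegree = n := by
      rw [Polynomial.natDegree_mul (Polynomial.X_sub_C_ne_zero b) hq₁,
        Polynomial.natDegree_X_sub_C] at hn
      omega
    refine ih q₁ hq₁ (fun w hw h0 => hq w hw (by simp [h0])) ?_ hdeg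
    refine eq_zero_of_drop_eq_smul (b := b) ?_ ?_
    · by_contra h
      exact hq b (not_le.1 h) (by simp)
    · rw [map_mul, Module.End.mul_apply, map_sub, Polynomial.aeval_X, Polynomial.aeval_C,
        LinearMap.sub_apply, Module.algebraMap_end_apply, sub_eq_zero] at hg
      exact hg

/-- The telescoping step: the shift pushes exactly the entry `n` out of the truncation. -/
theorem norm_head_succ_sq (n : ℕ) (f : ell2 V) :
    ‖head (n + 1) f‖ ^ 2 = ‖head (n + 1) (shift 1 f)‖ ^ 2 + ‖f n‖ ^ 2 := by
  rw [norm_head_sq, norm_head_sq, Finset.sum_range_succ, Finset.sum_range_succ' _ n]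
  simp [shift_apply_of_lt]

end ell2

theorem coeff_mul_eq_zero {s : Fin 2} {a b : ℕ} {p q : MvPolynomial (Fin 2) ℂ}
    (hp : ∀ m, a ≤ m s → coeff m p = 0) (hq : ∀ m, b + 1 ≤ m s → coeff m q = 0)
    (m : Fin 2 →₀ ℕ) (hm : a + b ≤ m s) : coeff m (p * q) = 0 := by
  rw [coeff_mul]
  refine Finset.sum_eq_zero fun x hx => ?_
  rw [Finset.HasAntidiagonal.mem_antidiagonal] at hx
  have h := DFunLike.congr_fun hx s
  rw [Finsupp.add_apply] at h
  by_cases h1 : a ≤ x.1 s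
  · rw [hp _ h1, zero_mul]
  · rw [hq _ (by omega), mul_zero]

/-- Division with remainder of a polynomial vector by a power of a variable. -/
theorem exists_eq_add_X_pow_smul {L : ℕ} (s : Fin 2) (n : ℕ) (c : VecPoly L) :
    ∃ c₀ c₁ : VecPoly L, c = c₀ + (X s : MvPolynomial (Fin 2) ℂ) ^ n • c₁ ∧
      ∀ k m, coeff m (c₀ k) = if n ≤ m s then 0 else coeff m (c k) := by
  refine ⟨fun k => (c k).modMonomial (Finsupp.single s n),
    fun k => (c k).divMonomial (Finsupp.single s n), ?_, ?_⟩
  · ext1 k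
    simp only [Pi.add_apply, Pi.smul_apply, smul_eq_mul, X_pow_eq_monomial]
    exact (modMonomial_add_divMonomial _ _).symm
  · intro k m
    have h : Finsupp.single s n ≤ m ↔ n ≤ m s := Finsupp.single_le_iff
    split_ifs with h1
    · exact coeff_modMonomial_of_le _ (h.2 h1)
    · exact coeff_modMonomial_of_not_le _ (fun h2 => h1 (h.1 h2))

/-- Polynomial vectors of degree less than `K` in both variables. -/
noncomputable def boxPoly (L K : ℕ) : Submodule ℂ (VecPoly L) where
  carrier := {c | ∀ i j, K ≤ i ∨ K ≤ j → vcoeff i j c = 0}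
  zero_mem' := fun i j _ => map_zero _
  add_mem' := fun {c d} hc hd i j h => by rw [map_add, hc i j h, hd i j h, add_zero]
  smul_mem' := fun a c hc i j h => by rw [map_smul, hc i j h, smul_zero]

instance (L K : ℕ) : FiniteDimensional ℂ (boxPoly L K) := by
  let T : boxPoly L K →ₗ[ℂ] (Fin K × Fin K → EuclideanSpace ℂ (Fin L)) :=
    LinearMap.pi (fun x => vcoeff x.1 x.2) ∘ₗ (boxPoly L K).subtype
  refine FiniteDimensional.of_injective T ?_
  rw [← LinearMap.ker_eq_bot, LinearMap.ker_eq_bot']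
  rintro ⟨c, hc⟩ h
  refine Subtype.ext ?_
  ext k m
  rw [← bideg_eta m]
  change vcoeff (m 0) (m 1) c k = 0
  by_cases hm : K ≤ m 0 ∨ K ≤ m 1
  · rw [hc _ _ hm]
    rfl
  · push Not at hm
    have h1 : vcoeff (m 0) (m 1) c = 0 := congrFun h (⟨m 0, hm.1⟩, ⟨m 1, hm.2⟩)
    rw [h1]
    rfl

/-- The source of finite dimensionality: modulo `z₁^K` and `z₂^K` only a finite box of coefficients
survives. -/
theorem exists_boxPoly_decomposition {L : ℕ} (K : ℕ) (c : VecPoly L) :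
    ∃ c₀ ∈ boxPoly L K, ∃ c₁ c₂ : VecPoly L,
      c = c₀ + (X 0 : MvPolynomial (Fin 2) ℂ) ^ K • c₁ +
        (X 1 : MvPolynomial (Fin 2) ℂ) ^ K • c₂ := by
  obtain ⟨d, c₁, hd, hd'⟩ := exists_eq_add_X_pow_smul 0 K c
  obtain ⟨e, c₂, he, he'⟩ := exists_eq_add_X_pow_smul 1 K d
  refine ⟨e, fun i j h => ?_, c₁, c₂, ?_⟩
  · ext k
    rw [vcoeff_apply, he', hd']
    simp only [bideg_apply_zero, bideg_apply_one]
    split_ifs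
    · rfl
    · rfl
    · omega
  · rw [hd, he]
    abel

/-- The value of a polynomial of bounded bidegree. -/
theorem eval_eq_sum_range {K : ℕ} {q : MvPolynomial (Fin 2) ℂ}
    (hq : ∀ i j, K ≤ i ∨ K ≤ j → coeff (bideg i j) q = 0) (z : Fin 2 → ℂ) :
    eval z q = ∑ i ∈ Finset.range K, ∑ j ∈ Finset.range K,
      z 0 ^ i * z 1 ^ j * coeff (bideg i j) q := by
  rw [eval_eq', ← Finset.sum_product']
  refine Finset.sum_bij_ne_zero (fun m _ _ => (m 0, m 1)) ?_ ?_ ?_ ?_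
  · intro m _ hm
    rw [Finset.mem_product, Finset.mem_range, Finset.mem_range]
    by_contra h
    apply hm
    have := hq (m 0) (m 1) (by simp only at h; omega)
    rw [bideg_eta] at this
    simp [this]
  · intro m _ _ n _ _ h
    rw [Prod.mk.injEq] at h
    rw [← bideg_eta m, ← bideg_eta n, h.1, h.2]
  · rintro ⟨i, j⟩ _ h
    have h' : coeff (bideg i j) q ≠ 0 := by
      rintro h0
      simp [h0] at h
    refine ⟨bideg i j, by simpa [mem_support_iff] using h', ?_, by simp⟩
    simpa [Fin.prod_univ_two, mul_comm] using h
  · intro m _ _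
    simp [bideg_eta, Fin.prod_univ_two, mul_comm]

/-- Multiplication by a one-variable polynomial without zeros in the disk has dense range. -/
theorem denseRange_toRow_polyMul {L K : ℕ} (p : MvPolynomial (Fin 2) ℂ)
    (hp : ∀ z ∈ bidisk, eval z p ≠ 0)
    (hK : ∀ i j, K ≤ i ∨ K ≤ j → coeff (bideg i j) p = 0) :
    DenseRange (toRow 0 ∘ₗ polyMul p : VecPoly L →ₗ[ℂ] _) := by
  let R := LinearMap.range (toRow 0 ∘ₗ polyMul p :
    VecPoly L →ₗ[ℂ] ell2 (EuclideanSpace ℂ (Fin L)))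
  have hK0 : 0 < K := by
    rcases Nat.eq_zero_or_pos K with rfl | h
    · refine absurd ?_ (hp 0 ⟨by simp, by simp⟩)
      rw [eval_eq_sum_range hK]
      simp
    · exact h
  suffices h : R.topologicalClosure = ⊤ by
    intro f
    have : f ∈ R.topologicalClosure := h ▸ Submodule.mem_top
    exact this
  rw [Submodule.topologicalClosure_eq_top_iff, Submodule.eq_bot_iff]
  intro g hg
  -- Row `0` of `p c` involves only `p(z₁, 0)`. The adjoint of multiplication by it is `q` evaluated
  -- at the backward shift, whence the conjugated coefficients.
  let q : Polynomial ℂ :=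
    ∑ l ∈ Finset.range K, Polynomial.monomial l (star (coeff (bideg l 0) p))
  have hqe : ∀ b, q.eval b = star (eval (fun i => if i = 0 then star b else 0) p) := by
    intro b
    have h1 : ∀ i, ∑ j ∈ Finset.range K, (star b) ^ i * (0 : ℂ) ^ j * coeff (bideg i j) p =
        (star b) ^ i * coeff (bideg i 0) p := by
      intro i
      rw [Finset.sum_eq_single_of_mem 0 (Finset.mem_range.2 hK0)]
      · simp
      · intro j _ hj
        simp [hj]
    rw [eval_eq_sum_range hK]
    simp only [if_true, one_ne_zero, if_false, h1, q, Polynomial.eval_finsetSum,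
      Polynomial.eval_monomial, star_sum, star_mul', star_pow, star_star]
    exact Finset.sum_congr rfl fun i _ => mul_comm _ _
  have hqne : ∀ b : ℂ, ‖b‖ < 1 → q.eval b ≠ 0 := by
    intro b hb h0
    rw [hqe, star_eq_zero] at h0
    exact hp _ ⟨by simpa using hb, by simp⟩ h0
  refine ell2.eq_zero_of_aeval_drop_eq_zero q (fun h => hqne 0 (by simp) (by simp [h])) hqne g ?_
  ext i : 2
  refine ext_inner_left ℂ fun e => ?_
  -- Testing orthogonality against `z₁^i e` reads off the entry `i` of `q(drop 1) g`.
  let c : VecPoly L := fun k => monomial (bideg i 0) (e k)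
  have hc : ∀ i', vcoeff i' 0 (p • c) = if i' < i then 0 else coeff (bideg (i' - i) 0) p • e := by
    intro i'
    have hc' : p • c = (X 0 : MvPolynomial (Fin 2) ℂ) ^ i • (fun k => p * C (e k) : VecPoly L) := by
      ext1 k
      have : bideg i 0 = Finsupp.single 0 i := by simp [bideg]
      simp only [c, this, Pi.smul_apply, smul_eq_mul, X_pow_eq_monomial, mul_left_comm _ p,
        mul_comm (monomial _ _) (C _), C_mul_monomial, mul_one]
    rw [hc', vcoeff_X_zero_pow_smul]
    split_ifs
    · rfl
    · ext k
      simp only [vcoeff_apply, PiLp.smul_apply, smul_eq_mul]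
      rw [mul_comm p, coeff_C_mul, mul_comm]
  have horth : ⟪toRow 0 (p • c), g⟫_ℂ = 0 := (Submodule.mem_orthogonal _ _).1 hg _ ⟨c, rfl⟩
  have hsum : toRow 0 (p • c) =
      ∑ l ∈ Finset.range K, lp.single 2 (l + i) (coeff (bideg l 0) p • e) := by
    ext i' : 2
    rw [toRow_apply, hc, lp.coeFn_sum, Finset.sum_apply]
    simp only [lp.coeFn_single, Pi.single_apply]
    split_ifs with h
    · symm
      exact Finset.sum_eq_zero fun l _ => if_neg (by omega)
    · by_cases h2 : i' - i < K
      · rw [Finset.sum_eq_single_of_mem (i' - i) (Finset.mem_range.2 h2), if_pos (by omega)]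
        exact fun l _ hl => if_neg (by omega)
      · rw [hK _ _ (Or.inl (not_lt.1 h2)), zero_smul, Finset.sum_eq_zero]
        exact fun l hl => if_neg (by have := Finset.mem_range.1 hl; omega)
  have haev : (Polynomial.aeval (ell2.drop 1 : Module.End ℂ (ell2 (EuclideanSpace ℂ (Fin L)))) q g) i
      = ∑ l ∈ Finset.range K, star (coeff (bideg l 0) p) • g (i + l) := by
    simp only [q, map_sum, Polynomial.aeval_monomial, LinearMap.sum_apply, Module.End.mul_apply,
      Module.algebraMap_end_apply, lp.coeFn_sum, Finset.sum_apply, lp.coeFn_smul, Pi.smul_apply,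
      ell2.drop_pow_apply]
  rw [haev, inner_sum]
  rw [hsum, sum_inner] at horth
  rw [show (0 : ell2 (EuclideanSpace ℂ (Fin L))) i = 0 from rfl, inner_zero_right, ← horth]
  refine Finset.sum_congr rfl fun l _ => ?_
  have h1 : ⟪lp.single 2 (l + i) (coeff (bideg l 0) p • e), g⟫_ℂ =
      ⟪coeff (bideg l 0) p • e, g (l + i)⟫_ℂ := lp.inner_single_left _ _ _
  rw [h1, inner_smul_left, inner_smul_right, add_comm i l]
  rfl

theorem polyMul_pow {L : ℕ} (q : MvPolynomial (Fin 2) ℂ) (m : ℕ) (c : VecPoly L) :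
    ((polyMul q : VecPoly L →ₗ[ℂ] VecPoly L) ^ m) c = q ^ m • c := by
  induction m generalizing c with
  | zero => simp
  | succ m ih =>
    rw [pow_succ, Module.End.mul_apply, ih, polyMul_apply, smul_smul, ← pow_succ]

theorem vcoeff_mulVec_eq_zero {M N K : ℕ} {Q : Matrix (Fin M) (Fin N) (MvPolynomial (Fin 2) ℂ)}
    {s : Fin 2} (hQ : ∀ k l m, K ≤ m s → coeff m (Q k l) = 0) {c : VecPoly N}
    (hc : ∀ k m, 1 ≤ m s → coeff m (c k) = 0) {i j : ℕ} (h : K ≤ bideg i j s) :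
    vcoeff i j (Q.mulVec c) = 0 := by
  ext k
  simp only [vcoeff_apply, Matrix.mulVec, dotProduct, coeff_sum]
  exact Finset.sum_eq_zero fun l _ =>
    coeff_mul_eq_zero (b := 0) (hQ k l) (by simpa using hc l) _ (by simpa using h)

theorem vcoeff_smul_eq_zero {N K : ℕ} {p : MvPolynomial (Fin 2) ℂ}
    {s : Fin 2} (hp : ∀ m, K ≤ m s → coeff m p = 0) {c : VecPoly N}
    (hc : ∀ k m, 1 ≤ m s → coeff m (c k) = 0) {i j : ℕ} (h : K ≤ bideg i j s) :
    vcoeff i j (p • c) = 0 := by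
  ext k
  exact coeff_mul_eq_zero (b := 0) hp (by simpa using hc k) _ (by simpa using h)

theorem mulVec_X_pow_smul {M N : ℕ} (Q : Matrix (Fin M) (Fin N) (MvPolynomial (Fin 2) ℂ))
    (s : Fin 2) (n : ℕ) (c : VecPoly N) :
    Q.mulVec ((X s : MvPolynomial (Fin 2) ℂ) ^ n • c) =
      (X s : MvPolynomial (Fin 2) ℂ) ^ n • Q.mulVec c :=
  Matrix.mulVec_smul _ _ _

theorem toRow_X_one_pow_smul {L : ℕ} (n j : ℕ) (c : VecPoly L) :
    toRow j ((X 1 : MvPolynomial (Fin 2) ℂ) ^ n • c) = if j < n then 0 else toRow (j - n) c := by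
  rw [← toSeq_apply, toSeq_X_one_pow_smul, ell2.shift_apply]
  rfl

/-! ### The two truncated defects and the energy balance -/

/-- The outer factor in the second variable: a shift-intertwining map whose norm is the truncated
defect of `Q / p` with respect to the second variable. -/
theorem exists_outer_factor {M N n : ℕ} (Q : Matrix (Fin M) (Fin N) (MvPolynomial (Fin 2) ℂ))
    (p : MvPolynomial (Fin 2) ℂ) (hp : ∀ z ∈ bidisk, eval z p ≠ 0)
    (hT : ∀ z ∈ bitorus, ∀ v : Fin N → ℂ,
      ∑ k, ‖(evalMatrix z Q).mulVec v k‖ ^ 2 = ‖eval z p‖ ^ 2 * ∑ k, ‖v k‖ ^ 2)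
    (hpK : ∀ s m, n + 1 ≤ m s → coeff m p = 0)
    (hQK : ∀ s k l m, n + 1 ≤ m s → coeff m (Q k l) = 0) :
    ∃ (r : ℕ) (A : VecPoly N →ₗ[ℂ] ell2 (EuclideanSpace ℂ (Fin r))), DenseRange A ∧
      (∀ c, A ((X 0 : MvPolynomial (Fin 2) ℂ) • c) = ell2.shift 1 (A c)) ∧
      (∀ c, ‖A c‖ ^ 2 + ‖toRow n (Q.mulVec c)‖ ^ 2 =
        ‖A ((X 1 : MvPolynomial (Fin 2) ℂ) • c)‖ ^ 2 + ‖toRow n (p • c)‖ ^ 2) ∧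
      (∀ c, A ((X 1 : MvPolynomial (Fin 2) ℂ) ^ (n + 1) • c) = 0) ∧
      (∀ c : VecPoly N, (∀ k m, 1 ≤ m 0 → coeff m (c k) = 0) → ∀ i, n + 1 ≤ i → A c i = 0) ∧
      (∀ c : VecPoly N, (∀ k m, 1 ≤ m 1 → coeff m (c k) = 0) → A c = 0) := by
  let x : VecPoly N →ₗ[ℂ] ell2 (ell2 (EuclideanSpace ℂ (Fin N))) :=
    ell2.head (n + 1) ∘ₗ toSeq ∘ₗ polyMul p
  let y : VecPoly N →ₗ[ℂ] ell2 (ell2 (EuclideanSpace ℂ (Fin M))) :=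
    ell2.head (n + 1) ∘ₗ toSeq ∘ₗ matMul Q
  obtain ⟨H, _, _, _, ι, hι, hin⟩ := exists_defect_space x y
    (fun c => norm_head_toSeq_le Q p hp hT (n + 1) c)
  have hnorm : ∀ c, ‖ι c‖ ^ 2 = ‖x c‖ ^ 2 - ‖y c‖ ^ 2 := norm_sq_of_inner_eq_sub hin
  have hx : ∀ c, ‖x c‖ ^ 2 = ∑ j ∈ Finset.range (n + 1), ‖toRow j (p • c)‖ ^ 2 :=
    fun c => ell2.norm_head_sq _ _
  have hy : ∀ c, ‖y c‖ ^ 2 = ∑ j ∈ Finset.range (n + 1), ‖toRow j (Q.mulVec c)‖ ^ 2 :=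
    fun c => ell2.norm_head_sq _ _
  have hι0 : ∀ c, x c = 0 → y c = 0 → ι c = 0 := fun c h1 h2 => by
    have := hnorm c
    rw [h1, h2] at this
    simpa using this
  have hιX1 : ∀ c, ι ((X 1 : MvPolynomial (Fin 2) ℂ) ^ (n + 1) • c) = 0 := fun c => by
    refine hι0 _ ?_ ?_
    · simp only [x, LinearMap.comp_apply, polyMul_apply]
      rw [smul_comm, toSeq_X_one_pow_smul, ell2.head_shift]
    · simp only [y, LinearMap.comp_apply, matMul_apply]
      rw [mulVec_X_pow_smul, toSeq_X_one_pow_smul, ell2.head_shift]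
  -- Multiplication by `z₁` shifts every row isometrically, so it preserves the defect form.
  have hιZ : ∀ c, ‖ι (polyMul (X 0) c)‖ = ‖ι c‖ := fun c => by
    rw [← sq_eq_sq₀ (norm_nonneg _) (norm_nonneg _), hnorm, hnorm, hx, hx, hy, hy, polyMul_apply]
    have h1 : ∀ j, ‖toRow j (p • (X 0 : MvPolynomial (Fin 2) ℂ) • c)‖ = ‖toRow j (p • c)‖ :=
      fun j => by
        rw [smul_comm, ← pow_one (X 0), toRow_X_zero_pow_smul, LinearIsometry.norm_map]
    have h2 : ∀ j, ‖toRow j (Q.mulVec ((X 0 : MvPolynomial (Fin 2) ℂ) • c))‖ =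
        ‖toRow j (Q.mulVec c)‖ := fun j => by
      rw [← pow_one (X 0), mulVec_X_pow_smul, toRow_X_zero_pow_smul, LinearIsometry.norm_map]
    simp only [h1, h2]
  have hnil : ∀ c m, (∀ i j, m ≤ i → vcoeff i j (p • c) = 0) →
      (∀ i j, m ≤ i → vcoeff i j (Q.mulVec c) = 0) →
      ∀ c', ⟪ι c, ι (((polyMul (X 0) : VecPoly N →ₗ[ℂ] VecPoly N) ^ m) c')⟫_ℂ = 0 := by
    intro c m h1 h2 c'
    rw [hin, polyMul_pow]
    have hz : ∀ {L : ℕ} (d d' : VecPoly L), (∀ i j, m ≤ i → vcoeff i j d = 0) →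
        ⟪ell2.head (n + 1) (toSeq d),
          ell2.head (n + 1) (toSeq ((X 0 : MvPolynomial (Fin 2) ℂ) ^ m • d'))⟫_ℂ = 0 := by
      intro L d d' hd
      refine ell2.inner_eq_zero_of_forall fun j => ?_
      rw [ell2.head_apply, ell2.head_apply]
      split_ifs
      · refine ell2.inner_eq_zero_of_forall fun i => ?_
        rw [toSeq_apply, toSeq_apply, toRow_apply, toRow_apply, vcoeff_X_zero_pow_smul]
        split_ifs with h
        · rw [inner_zero_right]
        · rw [hd i j (not_lt.1 h), inner_zero_left]
      · rw [inner_zero_left]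
    have e1 : ⟪x c, x ((X 0 : MvPolynomial (Fin 2) ℂ) ^ m • c')⟫_ℂ = 0 := by
      simp only [x, LinearMap.comp_apply, polyMul_apply]
      rw [smul_comm p]
      exact hz _ _ h1
    have e2 : ⟪y c, y ((X 0 : MvPolynomial (Fin 2) ℂ) ^ m • c')⟫_ℂ = 0 := by
      simp only [y, LinearMap.comp_apply, matMul_apply]
      rw [mulVec_X_pow_smul]
      exact hz _ _ h2
    rw [e1, e2, sub_zero]
  obtain ⟨r, A, hA, hAι, hAZ, hAdeg⟩ := exists_shift_model ι hι (polyMul (X 0)) hιZ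
    (fun c => by
      obtain ⟨D, hD⟩ := exists_vcoeff_bound (p • c)
      obtain ⟨D', hD'⟩ := exists_vcoeff_bound (Q.mulVec c)
      exact ⟨max D D', hnil c _ (fun i j h => hD i j (Or.inl (le_of_max_le_left h)))
        (fun i j h => hD' i j (Or.inl (le_of_max_le_right h)))⟩)
    (boxPoly N (n + 1)) (fun c => by
      obtain ⟨c₀, hc₀, c₁, c₂, rfl⟩ := exists_boxPoly_decomposition (n + 1) c
      -- Multiples of `z₂ⁿ⁺¹` are null, and `z₁ⁿ⁺¹ c₁` is `z₁` times `z₁ⁿ c₁`.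
      refine ⟨c₀, hc₀, (X 0 : MvPolynomial (Fin 2) ℂ) ^ n • c₁, ?_⟩
      rw [map_add, map_add, hιX1, add_zero, polyMul_apply, smul_smul, ← pow_succ'])
  have hA0 : ∀ c, ι c = 0 → A c = 0 := fun c h => by
    rw [← norm_eq_zero, hAι, h, norm_zero]
  refine ⟨r, A, hA, hAZ, fun c => ?_, fun c => hA0 _ (hιX1 c), fun c hc i hi => ?_,
    fun c hc => hA0 _ ?_⟩
  -- Multiplication by `z₂` moves each row up by one index, so the two truncated sums differ exactly
  -- by row `n`.
  · rw [hAι, hAι, hnorm, hnorm, hx, hx, hy, hy, Finset.sum_range_succ _ n, Finset.sum_range_succ _ n,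
      Finset.sum_range_succ' _ n, Finset.sum_range_succ' _ n, ← pow_one (X 1)]
    simp only [mulVec_X_pow_smul, smul_comm p, toRow_X_one_pow_smul]
    simp
    ring
  · exact hAdeg c (n + 1) (hnil c _
      (fun i j h => vcoeff_smul_eq_zero (hpK 0) hc (by simpa using h))
      (fun i j h => vcoeff_mulVec_eq_zero (hQK 0) hc (by simpa using h))) i hi
  -- If `c` is free of `z₂`, then `pc` and `Qc` have degree at most `n` in `z₂`: nothing is cut off
  -- and the defect is zero.
  · have h1 : x c = toSeq (p • c) := ell2.head_eq_self fun j hj => by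
      ext i : 2
      exact vcoeff_smul_eq_zero (hpK 1) hc (by simpa using hj)
    have h2 : y c = toSeq (Q.mulVec c) := ell2.head_eq_self fun j hj => by
      ext i : 2
      exact vcoeff_mulVec_eq_zero (hQK 1) hc (by simpa using hj)
    have := hnorm c
    rw [h1, h2, norm_toSeq_mulVec_eq Q p hT, sub_self] at this
    simpa using this

/-- The pairing of two linear maps, with values in the Hilbert sum. -/
noncomputable def l2pair {P A B : Type*} [AddCommGroup P] [Module ℂ P] [NormedAddCommGroup A]
    [InnerProductSpace ℂ A] [NormedAddCommGroup B] [InnerProductSpace ℂ B]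
    (f : P →ₗ[ℂ] A) (g : P →ₗ[ℂ] B) : P →ₗ[ℂ] WithLp 2 (A × B) :=
  (WithLp.linearEquiv 2 ℂ (A × B)).symm.toLinearMap ∘ₗ f.prod g

theorem l2pair_apply {P A B : Type*} [AddCommGroup P] [Module ℂ P] [NormedAddCommGroup A]
    [InnerProductSpace ℂ A] [NormedAddCommGroup B] [InnerProductSpace ℂ B]
    (f : P →ₗ[ℂ] A) (g : P →ₗ[ℂ] B) (c : P) : l2pair f g c = WithLp.toLp 2 (f c, g c) := rfl

theorem norm_toLp_prod_sq {A B : Type*} [NormedAddCommGroup A] [NormedAddCommGroup B] (a : A)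
    (b : B) : ‖(WithLp.toLp 2 (a, b) : WithLp 2 (A × B))‖ ^ 2 = ‖a‖ ^ 2 + ‖b‖ ^ 2 :=
  WithLp.prod_norm_sq_eq_of_L2 _

theorem norm_l2pair_sq {P A B : Type*} [AddCommGroup P] [Module ℂ P] [NormedAddCommGroup A]
    [InnerProductSpace ℂ A] [NormedAddCommGroup B] [InnerProductSpace ℂ B]
    (f : P →ₗ[ℂ] A) (g : P →ₗ[ℂ] B) (c : P) : ‖l2pair f g c‖ ^ 2 = ‖f c‖ ^ 2 + ‖g c‖ ^ 2 :=
  norm_toLp_prod_sq _ _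

/-- The shift on a Hilbert sum of two sequence spaces. -/
noncomputable def pairShift {V W : Type*} [NormedAddCommGroup V] [InnerProductSpace ℂ V]
    [NormedAddCommGroup W] [InnerProductSpace ℂ W] (n : ℕ) :
    WithLp 2 (ell2 V × ell2 W) →ₗᵢ[ℂ] WithLp 2 (ell2 V × ell2 W) where
  toFun u := WithLp.toLp 2 (ell2.shift n u.fst, ell2.shift n u.snd)
  map_add' u v := by
    simp only [WithLp.add_fst, WithLp.add_snd, map_add]
    rfl
  map_smul' a u := by
    simp only [WithLp.smul_fst, WithLp.smul_snd, map_smul]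
    rfl
  norm_map' u := by
    change ‖WithLp.toLp 2 (ell2.shift n u.fst, ell2.shift n u.snd)‖ = _
    rw [← sq_eq_sq₀ (norm_nonneg _) (norm_nonneg _), norm_toLp_prod_sq,
      LinearIsometry.norm_map, LinearIsometry.norm_map]
    exact (WithLp.prod_norm_sq_eq_of_L2 u).symm

/-- The truncated defect of a pair of shift-intertwining isometries between sums of sequence
spaces is positive semidefinite. -/
theorem exists_truncated_defect {P : Type} {V₁ V₂ W₁ W₂ : Type*} [AddCommGroup P] [Module ℂ P]
    [NormedAddCommGroup V₁] [InnerProductSpace ℂ V₁] [NormedAddCommGroup V₂]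
    [InnerProductSpace ℂ V₂] [NormedAddCommGroup W₁] [InnerProductSpace ℂ W₁]
    [NormedAddCommGroup W₂] [InnerProductSpace ℂ W₂]
    (x₁ : P →ₗ[ℂ] ell2 V₁) (x₂ : P →ₗ[ℂ] ell2 V₂) (y₁ : P →ₗ[ℂ] ell2 W₁) (y₂ : P →ₗ[ℂ] ell2 W₂)
    (hbal : ∀ c, ‖x₁ c‖ ^ 2 + ‖x₂ c‖ ^ 2 = ‖y₁ c‖ ^ 2 + ‖y₂ c‖ ^ 2)
    (hdense : DenseRange (l2pair x₁ x₂)) (n : ℕ) (Z : P →ₗ[ℂ] P)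
    (hx₁ : ∀ c, x₁ (Z c) = ell2.shift n (x₁ c)) (hx₂ : ∀ c, x₂ (Z c) = ell2.shift n (x₂ c))
    (hy₁ : ∀ c, y₁ (Z c) = ell2.shift n (y₁ c)) (hy₂ : ∀ c, y₂ (Z c) = ell2.shift n (y₂ c)) :
    ∃ (H : Type) (_ : NormedAddCommGroup H) (_ : InnerProductSpace ℂ H) (ι : P →ₗ[ℂ] H),
      ∀ c, ‖ι c‖ ^ 2 = ‖ell2.head n (x₁ c)‖ ^ 2 + ‖ell2.head n (x₂ c)‖ ^ 2 -
        (‖ell2.head n (y₁ c)‖ ^ 2 + ‖ell2.head n (y₂ c)‖ ^ 2) := by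
  have hle : ∀ c, ‖l2pair y₁ y₂ c‖ ≤ ‖l2pair x₁ x₂ c‖ := fun c => by
    rw [← sq_le_sq₀ (norm_nonneg _) (norm_nonneg _), norm_l2pair_sq, norm_l2pair_sq]
    exact (hbal c).ge
  let x : P →ₗ[ℂ] WithLp 2 (ell2 V₁ × ell2 V₂) := l2pair (ell2.head n ∘ₗ x₁) (ell2.head n ∘ₗ x₂)
  let y : P →ₗ[ℂ] WithLp 2 (ell2 W₁ × ell2 W₂) := l2pair (ell2.head n ∘ₗ y₁) (ell2.head n ∘ₗ y₂)
  have hxy : ∀ c, ‖y c‖ ≤ ‖x c‖ := by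
    intro c
    -- The distance argument again, now for the shift acting on both summands.
    refine le_norm_sub_of_contraction (l2pair x₁ x₂) (l2pair y₁ y₂) hle hdense Z (pairShift n)
      (fun c => ?_) c ‖y c‖ (fun c' => ?_)
      (WithLp.toLp 2 (ell2.drop n (x₁ c), ell2.drop n (x₂ c)))
    · rw [l2pair_apply, hx₁, hx₂]
      rfl
    · rw [← sq_le_sq₀ (norm_nonneg _) (norm_nonneg _), norm_l2pair_sq, norm_l2pair_sq]
      have e1 : ell2.head n (y₁ c) = ell2.head n (y₁ (c - Z c')) := by
        rw [map_sub, hy₁, map_sub, ell2.head_shift, sub_zero]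
      have e2 : ell2.head n (y₂ c) = ell2.head n (y₂ (c - Z c')) := by
        rw [map_sub, hy₂, map_sub, ell2.head_shift, sub_zero]
      rw [LinearMap.comp_apply, LinearMap.comp_apply, e1, e2]
      gcongr
      · exact ell2.norm_head_le _ _
      · exact ell2.norm_head_le _ _
  obtain ⟨H, i₁, i₂, _, ι, -, hin⟩ := exists_defect_space x y hxy
  refine ⟨H, i₁, i₂, ι, fun c => ?_⟩
  rw [norm_sq_of_inner_eq_sub hin, norm_l2pair_sq, norm_l2pair_sq]
  rfl

/-- The finite-dimensional energy balance behind the realization. -/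
theorem exists_energy_balance {M N n : ℕ} (Q : Matrix (Fin M) (Fin N) (MvPolynomial (Fin 2) ℂ))
    (p : MvPolynomial (Fin 2) ℂ) (hp : ∀ z ∈ bidisk, eval z p ≠ 0)
    (hT : ∀ z ∈ bitorus, ∀ v : Fin N → ℂ,
      ∑ k, ‖(evalMatrix z Q).mulVec v k‖ ^ 2 = ‖eval z p‖ ^ 2 * ∑ k, ‖v k‖ ^ 2)
    (hpK : ∀ s m, n + 1 ≤ m s → coeff m p = 0)
    (hQK : ∀ s k l m, n + 1 ≤ m s → coeff m (Q k l) = 0) :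
    ∃ (r : Fin 2 → ℕ) (F : ∀ s, VecPoly N →ₗ[ℂ] EuclideanSpace ℂ (Fin (r s))),
      (∀ c, ‖vcoeff n n (p • c)‖ ^ 2 + ∑ s, ‖F s ((X s : MvPolynomial (Fin 2) ℂ) • c)‖ ^ 2 =
        ‖vcoeff n n (Q.mulVec c)‖ ^ 2 + ∑ s, ‖F s c‖ ^ 2) ∧
      (∀ s c, F s ((X s : MvPolynomial (Fin 2) ℂ) ^ (n + 1) • c) = 0) ∧
      (∀ s, ∀ c : VecPoly N, (∀ k m, 1 ≤ m s → coeff m (c k) = 0) → F s c = 0) := by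
  obtain ⟨r₂, A, hA, hAX0, hAX1, hAn, hAdeg, hA0⟩ := exists_outer_factor Q p hp hT hpK hQK
  have hAX0' : ∀ m c, A ((X 0 : MvPolynomial (Fin 2) ℂ) ^ m • c) = ell2.shift m (A c) := by
    intro m c
    induction m with
    | zero =>
      ext i : 2
      simp [ell2.shift_apply]
    | succ m ih =>
      rw [pow_succ', mul_smul, hAX0, ih]
      ext i : 2
      simp only [ell2.shift_apply]
      rcases i with _ | i
      · simp
      · simp
  have hcomm : ∀ (a b : MvPolynomial (Fin 2) ℂ) (c : VecPoly N), a • b • c = b • a • c :=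
    fun a b c => smul_comm a b c
  -- The identity `hAX1` balances `(x₁, x₂)` against `(y₁, A)`. All four maps turn `z₁` into the
  -- shift, which permits a second truncation, in `z₁`.
  let x₁ : VecPoly N →ₗ[ℂ] ell2 (EuclideanSpace ℂ (Fin N)) := toRow n ∘ₗ polyMul p
  let x₂ : VecPoly N →ₗ[ℂ] ell2 (EuclideanSpace ℂ (Fin r₂)) := A ∘ₗ polyMul (X 1)
  let y₁ : VecPoly N →ₗ[ℂ] ell2 (EuclideanSpace ℂ (Fin M)) := toRow n ∘ₗ matMul Q
  have hx₁ : ∀ m c, x₁ ((X 0 : MvPolynomial (Fin 2) ℂ) ^ m • c) = ell2.shift m (x₁ c) :=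
    fun m c => by
      simp only [x₁, LinearMap.comp_apply, polyMul_apply]
      rw [smul_comm, toRow_X_zero_pow_smul]
  have hx₂ : ∀ m c, x₂ ((X 0 : MvPolynomial (Fin 2) ℂ) ^ m • c) = ell2.shift m (x₂ c) :=
    fun m c => by
      simp only [x₂, LinearMap.comp_apply, polyMul_apply]
      rw [hcomm, hAX0']
  have hy₁ : ∀ m c, y₁ ((X 0 : MvPolynomial (Fin 2) ℂ) ^ m • c) = ell2.shift m (y₁ c) :=
    fun m c => by
      simp only [y₁, LinearMap.comp_apply, matMul_apply]
      rw [mulVec_X_pow_smul, toRow_X_zero_pow_smul]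
  have hbal : ∀ c, ‖x₁ c‖ ^ 2 + ‖x₂ c‖ ^ 2 = ‖y₁ c‖ ^ 2 + ‖A c‖ ^ 2 := fun c => by
    have := hAX1 c
    simp only [x₁, x₂, y₁, LinearMap.comp_apply, polyMul_apply, matMul_apply]
    linarith
  -- density of the range of the "denominator"
  have hdense : DenseRange (l2pair x₁ x₂) := by
    refine Metric.denseRange_iff.2 fun u ε hε => ?_
    obtain ⟨c, hc⟩ := Metric.denseRange_iff.1 hA u.snd (ε / 2) (by positivity)
    -- Writing `c = c₀ + z₂ c₁` with `A c₀ = 0` gives `A c = x₂ c₁`, which settles the second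
    -- component. Adding `z₂ⁿ d` to `c₁` then corrects the first by row `0` of `p d` and leaves the
    -- second alone, as `A` kills `z₂ⁿ⁺¹ d`.
    obtain ⟨c₀, c₁, hcc, hc₀⟩ := exists_eq_add_X_pow_smul 1 1 c
    rw [pow_one] at hcc
    have hAc : A c = x₂ c₁ := by
      rw [hcc, map_add, hA0 c₀ fun k m hm => by rw [hc₀, if_pos hm], zero_add]
      rfl
    obtain ⟨d, hd⟩ := Metric.denseRange_iff.1 (denseRange_toRow_polyMul (L := N) (K := n + 1) p hp
      fun i j h => h.elim (fun h => hpK 0 _ (by simpa using h)) fun h => hpK 1 _ (by simpa using h))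
      (u.fst - x₁ c₁) (ε / 2) (by positivity)
    refine ⟨c₁ + (X 1 : MvPolynomial (Fin 2) ℂ) ^ n • d, ?_⟩
    have h1 : x₁ (c₁ + (X 1 : MvPolynomial (Fin 2) ℂ) ^ n • d) =
        x₁ c₁ + toRow 0 (p • d) := by
      rw [map_add]
      congr 1
      simp only [x₁, LinearMap.comp_apply, polyMul_apply]
      rw [smul_comm, toRow_X_one_pow_smul]
      simp
    have h2 : x₂ (c₁ + (X 1 : MvPolynomial (Fin 2) ℂ) ^ n • d) = x₂ c₁ := by
      rw [map_add]
      simp only [x₂, LinearMap.comp_apply, polyMul_apply]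
      rw [smul_smul, ← pow_succ', hAn, add_zero]
    rw [l2pair_apply, h1, h2, dist_eq_norm]
    rw [hAc, dist_eq_norm] at hc
    rw [LinearMap.comp_apply, polyMul_apply, dist_eq_norm] at hd
    have h3 : u - WithLp.toLp 2 (x₁ c₁ + toRow 0 (p • d), x₂ c₁) =
        WithLp.toLp 2 (u.fst - x₁ c₁ - toRow 0 (p • d), u.snd - x₂ c₁) := by
      rw [sub_sub]
      rfl
    rw [h3, ← sq_lt_sq₀ (norm_nonneg _) hε.le, norm_toLp_prod_sq]
    have hd' : ‖u.fst - x₁ c₁ - toRow 0 (p • d)‖ < ε / 2 := hd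
    have h4 := pow_lt_pow_left₀ hd' (norm_nonneg _) two_ne_zero
    have h5 := pow_lt_pow_left₀ hc (norm_nonneg _) two_ne_zero
    nlinarith
  obtain ⟨H, _, _, ι, hnorm⟩ := exists_truncated_defect x₁ x₂ y₁ A hbal hdense (n + 1)
    (polyMul ((X 0 : MvPolynomial (Fin 2) ℂ) ^ (n + 1))) (hx₁ _) (hx₂ _) (hy₁ _) (hAX0' _)
  have hιX0 : ∀ c, ι ((X 0 : MvPolynomial (Fin 2) ℂ) ^ (n + 1) • c) = 0 := fun c => by
    have := hnorm ((X 0 : MvPolynomial (Fin 2) ℂ) ^ (n + 1) • c)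
    rw [hx₁, hx₂, hy₁, hAX0'] at this
    simpa [ell2.head_shift] using this
  have hιX1 : ∀ c, ι ((X 1 : MvPolynomial (Fin 2) ℂ) ^ (n + 1) • c) = 0 := fun c => by
    have := hnorm ((X 1 : MvPolynomial (Fin 2) ℂ) ^ (n + 1) • c)
    have e1 : x₁ ((X 1 : MvPolynomial (Fin 2) ℂ) ^ (n + 1) • c) = 0 := by
      simp only [x₁, LinearMap.comp_apply, polyMul_apply]
      rw [smul_comm, toRow_X_one_pow_smul, if_pos n.lt_succ_self]
    have e2 : x₂ ((X 1 : MvPolynomial (Fin 2) ℂ) ^ (n + 1) • c) = 0 := by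
      simp only [x₂, LinearMap.comp_apply, polyMul_apply]
      rw [hcomm, hAn]
    have e3 : y₁ ((X 1 : MvPolynomial (Fin 2) ℂ) ^ (n + 1) • c) = 0 := by
      simp only [y₁, LinearMap.comp_apply, matMul_apply]
      rw [mulVec_X_pow_smul, toRow_X_one_pow_smul, if_pos n.lt_succ_self]
    rw [e1, e2, e3, hAn] at this
    simpa using this
  obtain ⟨r₁, G, hG⟩ := exists_euclidean_model ι (boxPoly N (n + 1)) fun c => by
    obtain ⟨c₀, hc₀, c₁, c₂, rfl⟩ := exists_boxPoly_decomposition (n + 1) c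
    exact ⟨c₀, hc₀, by rw [map_add, map_add, hιX0, hιX1, add_zero, add_zero]⟩
  -- Entry `n` of `A c` is what leaves the truncation under `z₁`; for `z₂ c` in place of `c` it is
  -- `x₂ c n`.
  let F₁ : VecPoly N →ₗ[ℂ] EuclideanSpace ℂ (Fin r₂) :=
    { toFun := fun c => A c n
      map_add' := fun c d => by rw [map_add]; rfl
      map_smul' := fun a c => by rw [map_smul]; rfl }
  refine ⟨![r₁, r₂], Fin.cons G (Fin.cons F₁ finZeroElim), fun c => ?_, ?_, ?_⟩
  · rw [Fin.sum_univ_two, Fin.sum_univ_two]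
    change ‖vcoeff n n (p • c)‖ ^ 2 + (‖G ((X 0 : MvPolynomial (Fin 2) ℂ) • c)‖ ^ 2 +
      ‖x₂ c n‖ ^ 2) = ‖vcoeff n n (Q.mulVec c)‖ ^ 2 + (‖G c‖ ^ 2 + ‖A c n‖ ^ 2)
    rw [hG, hG, hnorm, hnorm, ell2.norm_head_succ_sq n (x₁ c),
      ell2.norm_head_succ_sq n (x₂ c), ell2.norm_head_succ_sq n (y₁ c),
      ell2.norm_head_succ_sq n (A c), ← pow_one (X 0), hx₁, hx₂, hy₁, hAX0']
    have e1 : x₁ c n = vcoeff n n (p • c) := rfl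
    have e2 : y₁ c n = vcoeff n n (Q.mulVec c) := rfl
    rw [e1, e2]
    ring
  · rw [Fin.forall_fin_two]
    refine ⟨fun c => ?_, fun c => ?_⟩
    · change G _ = 0
      rw [← norm_eq_zero, hG, hιX0, norm_zero]
    · change A _ n = 0
      rw [hAn]
      rfl
  · rw [Fin.forall_fin_two]
    refine ⟨fun c hc => ?_, fun c hc => ?_⟩
    · change G _ = 0
      -- For `c` free of `z₁`, so is `z₂ c`. All four sequences then fit into the first `n + 1`
      -- entries, and the truncated defect is the full balance, namely zero.
      have hc' : ∀ k m, 1 ≤ m 0 → coeff m (((X 1 : MvPolynomial (Fin 2) ℂ) • c) k) = 0 := by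
        intro k m hm
        exact coeff_mul_eq_zero (s := 0) (a := 1) (b := 0) (fun m' hm' => by
          rw [coeff_X, if_neg]
          intro h
          rw [← h, Finsupp.single_apply, if_neg (by decide)] at hm'
          omega) (by simpa using hc k) m (by simpa using hm)
      have e1 : ell2.head (n + 1) (x₁ c) = x₁ c := ell2.head_eq_self fun i hi =>
        vcoeff_smul_eq_zero (hpK 0) hc (by simpa using hi)
      have e2 : ell2.head (n + 1) (x₂ c) = x₂ c := ell2.head_eq_self (hAdeg _ hc')
      have e3 : ell2.head (n + 1) (y₁ c) = y₁ c := ell2.head_eq_self fun i hi =>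
        vcoeff_mulVec_eq_zero (hQK 0) hc (by simpa using hi)
      have e4 : ell2.head (n + 1) (A c) = A c := ell2.head_eq_self (hAdeg _ hc)
      have := hnorm c
      rw [e1, e2, e3, e4, hbal, sub_self] at this
      rw [← norm_eq_zero, hG]
      simpa using this
    · change A _ n = 0
      rw [hA0 c hc]
      rfl

/-! ### The isometric colligation and the realization formula -/

/-- An isometric correspondence between subspaces extends to an isometric matrix. -/
theorem exists_isometric_matrix {P : Type*} {m n : Type} [AddCommGroup P] [Module ℂ P]
    [Fintype m] [DecidableEq m] [Fintype n] [DecidableEq n] (e : n ↪ m)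
    (L : P →ₗ[ℂ] EuclideanSpace ℂ n) (R : P →ₗ[ℂ] EuclideanSpace ℂ m)
    (h : ∀ c, ‖L c‖ = ‖R c‖) :
    ∃ U : Matrix m n ℂ, U.conjTranspose * U = 1 ∧ ∀ c, U.mulVec (L c) = R c := by
  let b := EuclideanSpace.basisFun n ℂ
  -- Embedding the source in the target along `e` turns `L c ↦ R c` into an isometry from a subspace
  -- of one finite-dimensional space into that space, and such a map extends.
  let J₀ : EuclideanSpace ℂ n →ₗ[ℂ] EuclideanSpace ℂ m :=
    b.toBasis.constr ℂ fun i => EuclideanSpace.basisFun m ℂ (e i)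
  let J : EuclideanSpace ℂ n →ₗᵢ[ℂ] EuclideanSpace ℂ m :=
    J₀.isometryOfOrthonormal (v := b.toBasis) (by simp [b.orthonormal]) (by
      have : J₀ ∘ b.toBasis = EuclideanSpace.basisFun m ℂ ∘ e := by
        ext1 i
        exact b.toBasis.constr_basis ℂ _ i
      rw [this]
      exact (EuclideanSpace.basisFun m ℂ).orthonormal.comp _ e.injective)
  let T := (J.toLinearMap ∘ₗ L).rangeRestrict
  have hTs : Function.Surjective T := LinearMap.surjective_rangeRestrict _
  have hTn : ∀ c, ‖T c‖ = ‖R c‖ := fun c => (J.norm_map (L c)).trans (h c)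
  let Φ := R.extendOfNorm T
  have hΦ : ∀ c, Φ (T c) = R c := fun c =>
    LinearMap.extendOfNorm_eq hTs.denseRange ⟨1, fun c => by rw [one_mul, hTn]⟩ c
  let Ψ : LinearMap.range (J.toLinearMap ∘ₗ L) →ₗᵢ[ℂ] EuclideanSpace ℂ m :=
    ⟨Φ.toLinearMap, fun w => by
      obtain ⟨c, rfl⟩ := hTs w
      exact (congrArg norm (hΦ c)).trans (hTn c).symm⟩
  let W : EuclideanSpace ℂ n →ₗᵢ[ℂ] EuclideanSpace ℂ m := Ψ.extend.comp J
  have hW : ∀ c, W (L c) = R c := fun c => by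
    have := Ψ.extend_apply (T c)
    exact this.trans (hΦ c)
  let U : Matrix m n ℂ := Matrix.toEuclideanLin.symm W.toLinearMap
  have hU : ∀ v : EuclideanSpace ℂ n, U.mulVec v = W v := fun v => by
    have h1 : Matrix.toEuclideanLin U = W.toLinearMap := LinearEquiv.apply_symm_apply _ _
    exact congrArg WithLp.ofLp (LinearMap.congr_fun h1 v)
  refine ⟨U, ?_, fun c => by rw [hU, hW]⟩
  have hcol : ∀ i j, U i j = W (b j) i := fun i j => by
    have := congrFun (hU (b j)) i
    rw [← this]
    simp [b]
  ext i j
  rw [Matrix.mul_apply]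
  simp only [Matrix.conjTranspose_apply, hcol]
  have h1 : ⟪W (b i), W (b j)⟫_ℂ = ⟪b i, b j⟫_ℂ := W.inner_map_map _ _
  rw [orthonormal_iff_ite.1 b.orthonormal, PiLp.inner_apply] at h1
  rw [Matrix.one_apply, ← h1]
  refine Finset.sum_congr rfl fun k _ => ?_
  rw [RCLike.inner_apply, mul_comm]
  rfl

/-- Coefficient extraction against a product of geometric sums evaluates a polynomial. -/
theorem coeff_mul_geom_sum {n : ℕ} {q : MvPolynomial (Fin 2) ℂ}
    (hq : ∀ s m, n + 1 ≤ m s → coeff m q = 0) (z : Fin 2 → ℂ) :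
    coeff (bideg n n) (q * ((∑ i ∈ Finset.range (n + 1), X 0 ^ i * C (z 0) ^ (n - i)) *
      ∑ j ∈ Finset.range (n + 1), X 1 ^ j * C (z 1) ^ (n - j))) = eval z q := by
  have hq' : ∀ i j, n + 1 ≤ i ∨ n + 1 ≤ j → coeff (bideg i j) q = 0 := fun i j h =>
    h.elim (fun h => hq 0 _ (by simpa using h)) fun h => hq 1 _ (by simpa using h)
  rw [eval_eq_sum_range hq', ← Finset.sum_range_reflect, Finset.sum_mul, Finset.mul_sum, coeff_sum]
  refine Finset.sum_congr rfl fun i hi => ?_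
  rw [← Finset.sum_range_reflect, Finset.mul_sum, Finset.mul_sum, coeff_sum]
  refine Finset.sum_congr rfl fun j hj => ?_
  rw [Finset.mem_range] at hi hj
  obtain ⟨hi₁, hi₂⟩ : n + 1 - 1 - i = n - i ∧ n - (n - i) = i := by omega
  obtain ⟨hj₁, hj₂⟩ : n + 1 - 1 - j = n - j ∧ n - (n - j) = j := by omega
  have h1 : q * (X 0 ^ (n - i) * C (z 0) ^ i * (X 1 ^ (n - j) * C (z 1) ^ j)) =
      C (z 0 ^ i * z 1 ^ j) * (X 0 ^ (n - i) * (X 1 ^ (n - j) * q)) := by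
    rw [C_mul, C_pow, C_pow]
    ring
  rw [hi₁, hi₂, hj₁, hj₂, h1, coeff_C_mul, coeff_X_zero_pow_mul, if_neg (by omega),
    coeff_X_one_pow_mul, if_neg (by omega), hi₂, hj₂]

/-- The geometric sum is an eigenvector of multiplication by `X s`, up to a multiple of `X s ^ (n +
1)` and a constant; the state map `F s` kills both corrections. -/
theorem X_sub_C_mul_geom_sum (s : Fin 2) (n : ℕ) (a : ℂ) :
    ((X s : MvPolynomial (Fin 2) ℂ) - C a) *
      (∑ i ∈ Finset.range (n + 1), X s ^ i * C a ^ (n - i)) = X s ^ (n + 1) - C a ^ (n + 1) := by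
  rw [mul_comm]
  exact geom_sum₂_mul (X s) (C a) (n + 1)

/-- A geometric sum in one variable does not involve the other. -/
theorem coeff_geom_sum_eq_zero {s t : Fin 2} (hst : s ≠ t) (n : ℕ) (a b : ℂ) (m : Fin 2 →₀ ℕ)
    (hm : 1 ≤ m s) :
    coeff m (C b * ∑ i ∈ Finset.range (n + 1), X t ^ i * C a ^ (n - i)) = 0 := by
  rw [coeff_C_mul, coeff_sum, Finset.sum_eq_zero, mul_zero]
  intro i _
  rw [← C_pow, mul_comm, coeff_C_mul, coeff_X_pow, if_neg, mul_zero]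
  rintro rfl
  rw [Finsupp.single_apply, if_neg hst.symm] at hm
  omega

/-- The realization theorem in terms of an energy balance. -/
theorem exists_realization_of_energy_balance {M N n : ℕ} (hNM : N ≤ M)
    (Q : Matrix (Fin M) (Fin N) (MvPolynomial (Fin 2) ℂ)) (p : MvPolynomial (Fin 2) ℂ)
    (hp : ∀ z ∈ bidisk, eval z p ≠ 0)
    (hpK : ∀ s m, n + 1 ≤ m s → coeff m p = 0)
    (hQK : ∀ s k l m, n + 1 ≤ m s → coeff m (Q k l) = 0)
    (r : Fin 2 → ℕ) (F : ∀ s, VecPoly N →ₗ[ℂ] EuclideanSpace ℂ (Fin (r s)))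
    (hbal : ∀ c, ‖vcoeff n n (p • c)‖ ^ 2 +
        ∑ s, ‖F s ((X s : MvPolynomial (Fin 2) ℂ) • c)‖ ^ 2 =
      ‖vcoeff n n (Q.mulVec c)‖ ^ 2 + ∑ s, ‖F s c‖ ^ 2)
    (hFpow : ∀ s c, F s ((X s : MvPolynomial (Fin 2) ℂ) ^ (n + 1) • c) = 0)
    (hF0 : ∀ s, ∀ c : VecPoly N, (∀ k m, 1 ≤ m s → coeff m (c k) = 0) → F s c = 0) :
    ∃ (r : ℕ) (A : Matrix (Fin M) (Fin N) ℂ) (B : Matrix (Fin M) (Fin r) ℂ)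
      (C : Matrix (Fin r) (Fin N) ℂ) (D : Matrix (Fin r) (Fin r) ℂ)
      (P₁ P₂ : Matrix (Fin r) (Fin r) ℂ),
      (Matrix.fromBlocks A B C D).conjTranspose * Matrix.fromBlocks A B C D = 1 ∧
      IsStarProjection P₁ ∧ IsStarProjection P₂ ∧ P₁ + P₂ = 1 ∧
      ∀ z ∈ bidisk, IsUnit (1 - D * pencil P₁ P₂ z) ∧
        (eval z p)⁻¹ • evalMatrix z Q =
          A + B * pencil P₁ P₂ z * (1 - D * pencil P₁ P₂ z)⁻¹ * C := by
  obtain ⟨R, ⟨e⟩⟩ : ∃ R, Nonempty ((Σ s, Fin (r s)) ≃ Fin R) := ⟨_, ⟨Fintype.equivFin _⟩⟩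
  let δ : Fin R → Fin 2 := fun i => (e.symm i).1
  let st : VecPoly N →ₗ[ℂ] (Fin R → ℂ) :=
    { toFun := fun c i => F (e.symm i).1 c (e.symm i).2
      map_add' := fun c d => by ext1 i; rw [map_add]; rfl
      map_smul' := fun a c => by ext1 i; rw [map_smul]; rfl }
  let sh : VecPoly N →ₗ[ℂ] (Fin R → ℂ) :=
    { toFun := fun c i =>
        F (e.symm i).1 ((X (e.symm i).1 : MvPolynomial (Fin 2) ℂ) • c) (e.symm i).2
      map_add' := fun c d => by ext1 i; rw [smul_add, map_add]; rfl
      map_smul' := fun a c => by ext1 i; rw [smul_comm, map_smul]; rfl }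
  let Lm : VecPoly N →ₗ[ℂ] EuclideanSpace ℂ (Fin N ⊕ Fin R) :=
    { toFun := fun c => WithLp.toLp 2 (Sum.elim (vcoeff n n (p • c)) (sh c))
      map_add' := fun c d => by
        ext i
        rcases i with i | i <;> simp [smul_add]
      map_smul' := fun a c => by
        ext i
        rcases i with i | i <;> simp [smul_comm p a c] }
  let Rm : VecPoly N →ₗ[ℂ] EuclideanSpace ℂ (Fin M ⊕ Fin R) :=
    { toFun := fun c => WithLp.toLp 2 (Sum.elim (vcoeff n n (Q.mulVec c)) (st c))
      map_add' := fun c d => by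
        ext i
        rcases i with i | i <;> simp [Matrix.mulVec_add]
      map_smul' := fun a c => by
        ext i
        rcases i with i | i <;> simp [Matrix.mulVec_smul] }
  have hnorm : ∀ c, ‖Lm c‖ = ‖Rm c‖ := fun c => by
    rw [← sq_eq_sq₀ (norm_nonneg _) (norm_nonneg _), EuclideanSpace.norm_sq_eq,
      EuclideanSpace.norm_sq_eq, Fintype.sum_sum_type, Fintype.sum_sum_type]
    have h1 : ∑ i, ‖sh c i‖ ^ 2 = ∑ s, ‖F s ((X s : MvPolynomial (Fin 2) ℂ) • c)‖ ^ 2 := by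
      simp only [EuclideanSpace.norm_sq_eq]
      rw [← Fintype.sum_sigma', ← Equiv.sum_comp e.symm]
      rfl
    have h2 : ∑ i, ‖st c i‖ ^ 2 = ∑ s, ‖F s c‖ ^ 2 := by
      simp only [EuclideanSpace.norm_sq_eq]
      rw [← Fintype.sum_sigma', ← Equiv.sum_comp e.symm]
      rfl
    have h3 := hbal c
    rw [← h1, ← h2, EuclideanSpace.norm_sq_eq, EuclideanSpace.norm_sq_eq] at h3
    exact h3
  obtain ⟨U, hU, hUc⟩ := exists_isometric_matrix
    ((Fin.castLEEmb hNM).sumMap (Function.Embedding.refl (Fin R))) Lm Rm hnorm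
  let Δ : (Fin 2 → ℂ) → Matrix (Fin R) (Fin R) ℂ := fun z => Matrix.diagonal fun i => z (δ i)
  let P : Fin 2 → Matrix (Fin R) (Fin R) ℂ := fun s =>
    Matrix.diagonal fun i => if δ i = s then 1 else 0
  have hP : ∀ s, IsStarProjection (P s) := fun s => by
    refine ⟨?_, ?_⟩
    · simp only [IsIdempotentElem, P, Matrix.diagonal_mul_diagonal]
      congr 1
      ext i
      split_ifs <;> simp
    · simp only [IsSelfAdjoint, P, Matrix.star_eq_conjTranspose, Matrix.diagonal_conjTranspose]
      congr 1
      ext i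
      simp only [Pi.star_apply]
      split_ifs <;> simp
  have hcases : ∀ s : Fin 2, s = 0 ∨ s = 1 := by decide
  have hPsum : P 0 + P 1 = 1 := by
    simp only [P, Matrix.diagonal_add]
    rw [← Matrix.diagonal_one]
    congr 1
    ext i
    rcases hcases (δ i) with h | h <;> simp [h]
  have hpencil : ∀ z, pencil (P 0) (P 1) z = Δ z := fun z => by
    simp only [pencil, P, Δ, ← Matrix.diagonal_smul, Matrix.diagonal_add]
    congr 1
    ext i
    rcases hcases (δ i) with h | h <;> simp [h]
  refine ⟨R, U.toBlocks₁₁, U.toBlocks₁₂, U.toBlocks₂₁, U.toBlocks₂₂, P 0, P 1, ?_, hP 0, hP 1,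
    hPsum, fun z hz => ?_⟩
  · rw [Matrix.fromBlocks_toBlocks, hU]
  rw [hpencil]
  have hiso : ∀ v : Fin N ⊕ Fin R → ℂ, ∑ i, ‖U.mulVec v i‖ ^ 2 = ∑ i, ‖v i‖ ^ 2 := by
    have hc : ∀ {k : Type} [Fintype k] (v : k → ℂ),
        ((∑ i, ‖v i‖ ^ 2 : ℝ) : ℂ) = star v ⬝ᵥ v := fun v => by
      simp only [dotProduct, Complex.ofReal_sum, Pi.star_apply]
      refine Finset.sum_congr rfl fun i _ => ?_
      rw [mul_comm, ← Complex.normSq_eq_norm_sq, ← Complex.mul_conj]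
      rfl
    intro v
    apply Complex.ofReal_injective
    rw [hc, hc, Matrix.star_mulVec, ← Matrix.dotProduct_mulVec, Matrix.mulVec_mulVec, hU,
      Matrix.one_mulVec]
  have hsplit : ∀ v w, U.mulVec (Sum.elim v w) =
      Sum.elim (U.toBlocks₁₁.mulVec v + U.toBlocks₁₂.mulVec w)
        (U.toBlocks₂₁.mulVec v + U.toBlocks₂₂.mulVec w) := fun v w => by
    conv_lhs => rw [← Matrix.fromBlocks_toBlocks U, Matrix.fromBlocks_mulVec]
    rfl
  have hunit : IsUnit (1 - U.toBlocks₂₂ * Δ z) := by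
    rw [← Matrix.mulVec_injective_iff_isUnit]
    refine (injective_iff_map_eq_zero (1 - U.toBlocks₂₂ * Δ z).mulVecLin).2 fun x hx => ?_
    rw [Matrix.mulVecLin_apply, Matrix.sub_mulVec, Matrix.one_mulVec, ← Matrix.mulVec_mulVec,
      sub_eq_zero] at hx
    have hzδ : ∀ i, ‖z (δ i)‖ < 1 := fun i => by
      rcases hcases (δ i) with h | h
      · rw [h]; exact hz.1
      · rw [h]; exact hz.2
    -- If `DΔx = x`, isometry of `U` on `(0, Δx)` gives `‖x‖ ≤ ‖Δx‖`. Each diagonal entry of `Δ` has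
    -- modulus below `1`, so `x = 0`.
    have h1 := hiso (Sum.elim 0 ((Δ z).mulVec x))
    rw [hsplit, Matrix.mulVec_zero, Matrix.mulVec_zero, zero_add, zero_add, ← hx,
      Fintype.sum_sum_type, Fintype.sum_sum_type] at h1
    simp only [Sum.elim_inl, Sum.elim_inr, Pi.zero_apply, norm_zero, Δ, Matrix.mulVec_diagonal,
      norm_mul, mul_pow] at h1
    have h2 : ∑ i, (1 - ‖z (δ i)‖ ^ 2) * ‖x i‖ ^ 2 ≤ 0 := by
      simp only [sub_mul, one_mul, Finset.sum_sub_distrib]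
      rw [zero_pow two_ne_zero, Finset.sum_const_zero, zero_add] at h1
      exact sub_nonpos.2 (h1 ▸ le_add_of_nonneg_left (Finset.sum_nonneg fun i _ => sq_nonneg _))
    have h3 : ∀ i ∈ Finset.univ, 0 ≤ (1 - ‖z (δ i)‖ ^ 2) * ‖x i‖ ^ 2 := fun i _ => by
      have := hzδ i
      have h4 : ‖z (δ i)‖ ^ 2 < 1 := by
        have := norm_nonneg (z (δ i))
        nlinarith
      exact mul_nonneg (by linarith) (sq_nonneg _)
    ext i
    have h5 := (Finset.sum_eq_zero_iff_of_nonneg h3).1 (le_antisymm h2 (Finset.sum_nonneg h3)) i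
      (Finset.mem_univ i)
    have h6 : 1 - ‖z (δ i)‖ ^ 2 ≠ 0 := by
      have := hzδ i
      have := norm_nonneg (z (δ i))
      nlinarith
    simpa [h6] using h5
  refine ⟨hunit, ?_⟩
  -- the generating function of the state map
  have hkey : ∀ v : Fin N → ℂ, ∃ x : Fin R → ℂ,
      U.mulVec (Sum.elim (eval z p • v) ((Δ z).mulVec x)) =
        Sum.elim ((evalMatrix z Q).mulVec v) x := by
    intro v
    -- With these sums the coefficient `(n, n)` of `q S₀ S₁` is `q(z)`, and `F s` turns
    -- multiplication by `X s` into the scalar `z s`.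
    let S : Fin 2 → MvPolynomial (Fin 2) ℂ := fun s =>
      ∑ i ∈ Finset.range (n + 1), X s ^ i * C (z s) ^ (n - i)
    let c : VecPoly N := fun k => C (v k) * (S 0 * S 1)
    have hc : ∀ s, F s ((X s : MvPolynomial (Fin 2) ℂ) • c) = z s • F s c := by
      intro s
      obtain ⟨t, hst, hSt⟩ : ∃ t, s ≠ t ∧ S 0 * S 1 = S s * S t := by
        rcases hcases s with rfl | rfl
        · exact ⟨1, by decide, rfl⟩
        · exact ⟨0, by decide, mul_comm _ _⟩
      let d : VecPoly N := fun k => C (v k) * S t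
      have h1 : (X s : MvPolynomial (Fin 2) ℂ) • c =
          z s • c + (X s : MvPolynomial (Fin 2) ℂ) ^ (n + 1) • d - (z s) ^ (n + 1) • d := by
        ext1 k
        have := X_sub_C_mul_geom_sum s n (z s)
        simp only [c, d, Pi.smul_apply, Pi.add_apply, Pi.sub_apply, smul_eq_mul, smul_eq_C_mul,
          hSt, C_pow]
        linear_combination (C (v k) * S t) * this
      rw [h1, map_sub, map_add, hFpow, map_smul, map_smul,
        hF0 s d fun k m hm => coeff_geom_sum_eq_zero hst n (z t) (v k) m hm]
      simp
    refine ⟨st c, ?_⟩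
    have h1 := hUc c
    have h2 : (Lm c : Fin N ⊕ Fin R → ℂ) = Sum.elim (eval z p • v) ((Δ z).mulVec (st c)) := by
      ext i
      rcases i with k | i
      · change coeff (bideg n n) (p * (C (v k) * (S 0 * S 1))) = eval z p * v k
        rw [mul_left_comm, coeff_C_mul, coeff_mul_geom_sum hpK, mul_comm]
      · change F (δ i) ((X (δ i) : MvPolynomial (Fin 2) ℂ) • c) (e.symm i).2 = _
        rw [hc]
        simp only [Sum.elim_inr, Δ, Matrix.mulVec_diagonal]
        rfl
    have h3 : (Rm c : Fin M ⊕ Fin R → ℂ) = Sum.elim ((evalMatrix z Q).mulVec v) (st c) := by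
      ext i
      rcases i with k | i
      · change coeff (bideg n n) (∑ l, Q k l * (C (v l) * (S 0 * S 1))) =
          ∑ l, eval z (Q k l) * v l
        rw [coeff_sum]
        refine Finset.sum_congr rfl fun l _ => ?_
        rw [mul_left_comm, coeff_C_mul, coeff_mul_geom_sum fun s => hQK s k l, mul_comm]
      · rfl
    rw [h2, h3] at h1
    exact h1
  have hdet : IsUnit (1 - U.toBlocks₂₂ * Δ z).det := (Matrix.isUnit_iff_isUnit_det _).1 hunit
  refine Matrix.mulVec_injective (funext fun v => ?_)
  obtain ⟨x, hx⟩ := hkey v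
  rw [hsplit] at hx
  have h1 := congrArg (fun f => f ∘ Sum.inl) hx
  have h2 := congrArg (fun f => f ∘ Sum.inr) hx
  simp only [Sum.elim_comp_inl, Sum.elim_comp_inr] at h1 h2
  have h3 : x = (1 - U.toBlocks₂₂ * Δ z)⁻¹.mulVec (U.toBlocks₂₁.mulVec (eval z p • v)) := by
    have h4 : (1 - U.toBlocks₂₂ * Δ z).mulVec x = U.toBlocks₂₁.mulVec (eval z p • v) := by
      rw [Matrix.sub_mulVec, Matrix.one_mulVec, ← Matrix.mulVec_mulVec, sub_eq_iff_eq_add]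
      exact h2.symm
    rw [← h4, Matrix.mulVec_mulVec, Matrix.nonsing_inv_mul _ hdet, Matrix.one_mulVec]
  rw [Matrix.smul_mulVec, ← h1, h3]
  simp only [Matrix.mulVec_smul, Matrix.add_mulVec, ← Matrix.mulVec_mulVec, ← smul_add]
  rw [inv_smul_smul₀ (hp z hz)]

/-! ### Identities on the torus and lowest terms -/

/-- On the torus, complex conjugates of polynomials are polynomials up to a monomial factor. -/
theorem exists_conj_on_bitorus (q : MvPolynomial (Fin 2) ℂ) :
    ∃ D₀ : ℕ, ∀ D, D₀ ≤ D → ∃ q' : MvPolynomial (Fin 2) ℂ, ∀ z ∈ bitorus,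
      eval z q' = (z 0 * z 1) ^ D * star (eval z q) := by
  induction q using MvPolynomial.induction_on with
  | C a => exact ⟨0, fun D _ => ⟨(X 0 * X 1) ^ D * C (star a), fun z _ => by simp⟩⟩
  | add p q hp hq =>
    obtain ⟨D₁, h₁⟩ := hp
    obtain ⟨D₂, h₂⟩ := hq
    -- Allowing every large exponent `D` lets both summands share one monomial factor.
    refine ⟨max D₁ D₂, fun D hD => ?_⟩
    obtain ⟨p', hp'⟩ := h₁ D (le_of_max_le_left hD)
    obtain ⟨q', hq'⟩ := h₂ D (le_of_max_le_right hD)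
    exact ⟨p' + q', fun z hz => by rw [map_add, hp' z hz, hq' z hz, map_add, star_add, mul_add]⟩
  | mul_X p i hp =>
    obtain ⟨D₁, h₁⟩ := hp
    refine ⟨D₁ + 1, fun D hD => ?_⟩
    obtain ⟨D, rfl⟩ := Nat.exists_eq_add_of_le' (Nat.one_le_of_lt hD)
    obtain ⟨p', hp'⟩ := h₁ D (by omega)
    have hconj : ∀ w : ℂ, ‖w‖ = 1 → w * star w = 1 := fun w hw => by
      have := Complex.mul_conj w
      rw [Complex.normSq_eq_norm_sq, hw] at this
      simpa using this
    -- On the torus `z₁ z₂` times the conjugate of one coordinate is the other coordinate.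
    obtain ⟨t, ht⟩ : ∃ t, ∀ z ∈ bitorus, z 0 * z 1 * star (z i) = z t := by
      fin_cases i
      · refine ⟨1, fun z hz => ?_⟩
        have := hconj _ hz.1
        simp only [Fin.zero_eta]
        linear_combination z 1 * this
      · refine ⟨0, fun z hz => ?_⟩
        have := hconj _ hz.2
        simp only [Fin.mk_one]
        linear_combination z 0 * this
    refine ⟨p' * X t, fun z hz => ?_⟩
    rw [map_mul, map_mul, hp' z hz, eval_X, eval_X, ← ht z hz, star_mul']
    ring

/-- The torus is a product of infinite sets, and a polynomial vanishing on such a product is zero.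
-/
theorem eq_zero_of_eval_bitorus {q : MvPolynomial (Fin 2) ℂ} (h : ∀ z ∈ bitorus, eval z q = 0) :
    q = 0 := by
  have hinf : (Metric.sphere (0 : ℂ) 1).Infinite := by
    have _ : Infinite (Set.Ioo (0 : ℝ) 1) := Set.Ioo.infinite one_pos
    have : (Set.range fun t : Set.Ioo (0 : ℝ) 1 => Complex.exp (t * Complex.I)).Infinite := by
      refine Set.infinite_range_of_injective fun s t hst => ?_
      have h1 := congrArg Complex.re hst
      simp only [Complex.exp_ofReal_mul_I_re] at h1
      have hpi := Real.pi_gt_three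
      exact Subtype.ext (Real.injOn_cos ⟨s.2.1.le, by linarith [s.2.2]⟩
        ⟨t.2.1.le, by linarith [t.2.2]⟩ h1)
    refine this.mono ?_
    rintro _ ⟨t, rfl⟩
    rw [mem_sphere_zero_iff_norm]
    exact Complex.norm_exp_ofReal_mul_I _
  refine funext_set (fun _ => Metric.sphere (0 : ℂ) 1) (fun _ => hinf) fun z hz => ?_
  rw [map_zero]
  exact h z ⟨by simpa using hz 0 trivial, by simpa using hz 1 trivial⟩

/-- An identity `Q* Q = |p|²` which holds generically on the torus holds everywhere on it. -/
theorem conjTranspose_mul_eq_on_bitorus {M N : ℕ}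
    (Q : Matrix (Fin M) (Fin N) (MvPolynomial (Fin 2) ℂ)) (p q : MvPolynomial (Fin 2) ℂ)
    (hq : q ≠ 0)
    (h : ∀ z ∈ bitorus, eval z q ≠ 0 → (evalMatrix z Q).conjTranspose * evalMatrix z Q =
      (star (eval z p) * eval z p) • (1 : Matrix (Fin N) (Fin N) ℂ)) (z : Fin 2 → ℂ)
    (hz : z ∈ bitorus) :
    (evalMatrix z Q).conjTranspose * evalMatrix z Q =
      (star (eval z p) * eval z p) • (1 : Matrix (Fin N) (Fin N) ℂ) := by
  choose D hD using fun x : Fin M × Fin N => exists_conj_on_bitorus (Q x.1 x.2)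
  obtain ⟨D', hD'⟩ := exists_conj_on_bitorus p
  let E := max D' (Finset.univ.sup D)
  choose Q' hQ' using fun x : Fin M × Fin N =>
    hD x E ((Finset.le_sup (Finset.mem_univ x)).trans (le_max_right _ _))
  obtain ⟨p', hp'⟩ := hD' E (le_max_left _ _)
  ext i j
  -- On the torus `R` is the entry `(i, j)` of the difference of the two sides, times `(z₁ z₂)^E`.
  -- As `q R` vanishes there, `R = 0`.
  let R : MvPolynomial (Fin 2) ℂ :=
    (∑ k, Q' (k, i) * Q k j) - C ((1 : Matrix (Fin N) (Fin N) ℂ) i j) * (p' * p)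
  have hR : ∀ w ∈ bitorus, eval w R = (w 0 * w 1) ^ E *
      (((evalMatrix w Q).conjTranspose * evalMatrix w Q) i j -
        ((star (eval w p) * eval w p) • (1 : Matrix (Fin N) (Fin N) ℂ)) i j) := by
    intro w hw
    simp only [R, map_sub, map_sum, map_mul, hQ' _ w hw, hp' w hw, eval_C, Matrix.mul_apply,
      Matrix.conjTranspose_apply, Matrix.smul_apply, smul_eq_mul, evalMatrix, Matrix.map_apply,
      mul_sub, Finset.mul_sum]
    congr 1
    · exact Finset.sum_congr rfl fun k _ => by ring
    · ring
  have hqR : q * R = 0 := eq_zero_of_eval_bitorus fun w hw => by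
    rw [map_mul]
    by_cases hw0 : eval w q = 0
    · rw [hw0, zero_mul]
    · rw [hR w hw, h w hw hw0, sub_self, mul_zero, mul_zero]
  have hR0 : R = 0 := (mul_eq_zero.1 hqR).resolve_left hq
  have h1 := hR z hz
  rw [hR0, map_zero, eq_comm, mul_eq_zero] at h1
  have hz0 : (z 0 * z 1) ^ E ≠ 0 := by
    refine pow_ne_zero _ (mul_ne_zero ?_ ?_)
    · intro h0
      simpa [h0] using hz.1
    · intro h0
      simpa [h0] using hz.2
  exact sub_eq_zero.1 (h1.resolve_left hz0)

/-- A representation of a rational matrix function in lowest terms. -/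
theorem exists_lowest_terms {M N : ℕ} (Q : Matrix (Fin M) (Fin N) (MvPolynomial (Fin 2) ℂ))
    (p : MvPolynomial (Fin 2) ℂ) (hp : p ≠ 0) :
    ∃ (g p₀ : MvPolynomial (Fin 2) ℂ) (Q₀ : Matrix (Fin M) (Fin N) (MvPolynomial (Fin 2) ℂ)),
      p = g * p₀ ∧ Q = g • Q₀ ∧
        ∀ (Q' : Matrix (Fin M) (Fin N) (MvPolynomial (Fin 2) ℂ)) (p' : MvPolynomial (Fin 2) ℂ),
          p' • Q = p • Q' → p₀ ∣ p' ∧ p' • Q₀ = p₀ • Q' := by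
  let _ : StrongNormalizationMonoid (MvPolynomial (Fin 2) ℂ) :=
    UniqueFactorizationMonoid.strongNormalizationMonoid
  let _ : NormalizedGCDMonoid (MvPolynomial (Fin 2) ℂ) :=
    UniqueFactorizationMonoid.toNormalizedGCDMonoid _
  let f : Option (Fin M × Fin N) → MvPolynomial (Fin 2) ℂ :=
    fun b => b.elim p fun x => Q x.1 x.2
  obtain ⟨h, hf, hh⟩ := Finset.extract_gcd f (s := Finset.univ) ⟨none, Finset.mem_univ _⟩
  let g := Finset.univ.gcd f
  have hpg : p = g * h none := hf none (Finset.mem_univ _)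
  have hQg : Q = g • Matrix.of fun k l => h (some (k, l)) := by
    ext1 k l
    exact hf (some (k, l)) (Finset.mem_univ _)
  have hg : g ≠ 0 := by
    rintro h0
    rw [h0, zero_mul] at hpg
    exact hp hpg
  refine ⟨g, h none, Matrix.of fun k l => h (some (k, l)), hpg, hQg, fun Q' p' hQp => ?_⟩
  have hred : p' • (Matrix.of fun k l => h (some (k, l)) : Matrix (Fin M) (Fin N) _) =
      h none • Q' := by
    rw [hQg, hpg] at hQp
    ext1 k l
    have h1 := congrFun (congrFun hQp k) l
    simp only [Matrix.smul_apply, smul_eq_mul] at h1 ⊢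
    refine mul_left_cancel₀ hg ?_
    linear_combination h1
  refine ⟨?_, hred⟩
  -- The reduced entries have gcd `1`, so the gcd of their multiples by `p'` is associated to `p'`.
  have hdvd : h none ∣ Finset.univ.gcd fun b => p' * h b := by
    refine Finset.dvd_gcd fun b _ => ?_
    rcases b with _ | ⟨k, l⟩
    · exact dvd_mul_left _ _
    · have h1 := congrFun (congrFun hred k) l
      simp only [Matrix.smul_apply, smul_eq_mul, Matrix.of_apply] at h1
      rw [h1]
      exact dvd_mul_right _ _
  have hassoc := Finset.gcd_mul_left' Finset.univ h p'
  rw [hh, mul_one] at hassoc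
  exact hdvd.trans hassoc.dvd

theorem exists_degree_bound {M N : ℕ} (Q : Matrix (Fin M) (Fin N) (MvPolynomial (Fin 2) ℂ))
    (p : MvPolynomial (Fin 2) ℂ) : ∃ n, (∀ s m, n + 1 ≤ m s → coeff m p = 0) ∧
      ∀ s k l m, n + 1 ≤ m s → coeff m (Q k l) = 0 := by
  obtain ⟨D, hD⟩ := exists_coeff_bound_forall
    fun b : Option (Fin M × Fin N) => b.elim p fun x => Q x.1 x.2
  have h : ∀ b s (m : Fin 2 →₀ ℕ), D + 1 ≤ m s →
      coeff m (Option.elim b p fun x : Fin M × Fin N => Q x.1 x.2) = 0 := by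
    intro b s m hm
    rw [← bideg_eta m]
    refine hD b _ _ ?_
    fin_cases s
    · exact Or.inl (Nat.le_of_succ_le hm)
    · exact Or.inr (Nat.le_of_succ_le hm)
  exact ⟨D, h none, fun s k l => h (some (k, l)) s⟩

/-! ### Proof of the realization theorem -/

open Matrix in
theorem theorem1p1 (M N : ℕ) (S : bidisk → Matrix (Fin M) (Fin N) ℂ)
    (Q : Matrix (Fin M) (Fin N) (MvPolynomial (Fin 2) ℂ)) (p : MvPolynomial (Fin 2) ℂ)
    (hp : p ≠ 0)
    (hS : ∀ z : bidisk, HasFractionValueAt Q p z (S z))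
    (hiso : ∀ z ∈ bitorus, MvPolynomial.eval z p ≠ 0 →
      ((MvPolynomial.eval z p)⁻¹ • evalMatrix z Q)ᴴ *
        ((MvPolynomial.eval z p)⁻¹ • evalMatrix z Q) = 1) :
    ∃ (r : ℕ) (A : Matrix (Fin M) (Fin N) ℂ) (B : Matrix (Fin M) (Fin r) ℂ)
      (C : Matrix (Fin r) (Fin N) ℂ) (D : Matrix (Fin r) (Fin r) ℂ)
      (P₁ P₂ : Matrix (Fin r) (Fin r) ℂ),
      (Matrix.fromBlocks A B C D)ᴴ * Matrix.fromBlocks A B C D = 1 ∧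
      IsStarProjection P₁ ∧ IsStarProjection P₂ ∧ P₁ + P₂ = 1 ∧
      ∀ z : bidisk, IsUnit (1 - D * pencil P₁ P₂ z) ∧
        S z = A + B * pencil P₁ P₂ z * (1 - D * pencil P₁ P₂ z)⁻¹ * C := by
  obtain ⟨g, p₀, Q₀, hpg, hQg, hmin⟩ := exists_lowest_terms Q p hp
  -- The reduced denominator divides the denominator of every local representation, so it vanishes
  -- nowhere in the bidisk.
  have hval : ∀ z : bidisk, eval z.1 p₀ ≠ 0 ∧ S z = (eval z.1 p₀)⁻¹ • evalMatrix z.1 Q₀ := by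
    intro z
    obtain ⟨Q', p', hp', hQp, hSz⟩ := hS z
    obtain ⟨⟨u, hu⟩, hred⟩ := hmin Q' p' hQp
    have h0 : eval z.1 p₀ ≠ 0 := fun h0 => hp' (by rw [hu, map_mul, h0, zero_mul])
    refine ⟨h0, ?_⟩
    rw [hSz]
    ext k l
    have h1 := congrArg (eval z.1) (congrFun (congrFun hred k) l)
    simp only [Matrix.smul_apply, smul_eq_mul, map_mul] at h1
    simp only [evalMatrix, Matrix.smul_apply, Matrix.map_apply, smul_eq_mul]
    field_simp
    linear_combination -h1
  have hp₀ : ∀ z ∈ bidisk, eval z p₀ ≠ 0 := fun z hz => (hval ⟨z, hz⟩).1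
  have hmat := conjTranspose_mul_eq_on_bitorus Q₀ p₀ p hp fun z hz hz0 => by
    have h1 := hiso z hz hz0
    have h2 : eval z g ≠ 0 ∧ eval z p₀ ≠ 0 := by
      rw [hpg, map_mul] at hz0
      exact mul_ne_zero_iff.1 hz0
    have h3 : (eval z p)⁻¹ • evalMatrix z Q = (eval z p₀)⁻¹ • evalMatrix z Q₀ := by
      ext k l
      simp only [hpg, hQg, evalMatrix, Matrix.smul_apply, Matrix.map_apply, smul_eq_mul, map_mul]
      have := h2.1
      have := h2.2
      field_simp
    rw [h3, Matrix.conjTranspose_smul, Matrix.smul_mul, Matrix.mul_smul, smul_smul] at h1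
    have h4 : star (eval z p₀) ≠ 0 := star_ne_zero.2 h2.2
    rw [← h1, smul_smul, star_inv₀]
    have h5 : star (eval z p₀) * eval z p₀ * ((star (eval z p₀))⁻¹ * (eval z p₀)⁻¹) = 1 := by
      have := h2.2
      field_simp
    rw [h5, one_smul]
  have hT : ∀ z ∈ bitorus, ∀ v : Fin N → ℂ,
      ∑ k, ‖(evalMatrix z Q₀).mulVec v k‖ ^ 2 = ‖eval z p₀‖ ^ 2 * ∑ k, ‖v k‖ ^ 2 := by
    have hc : ∀ {k : ℕ} (v : Fin k → ℂ), ((∑ i, ‖v i‖ ^ 2 : ℝ) : ℂ) = star v ⬝ᵥ v := fun v => by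
      simp only [dotProduct, Complex.ofReal_sum, Pi.star_apply]
      refine Finset.sum_congr rfl fun i _ => ?_
      rw [mul_comm, ← Complex.normSq_eq_norm_sq, ← Complex.mul_conj]
      rfl
    intro z hz v
    apply Complex.ofReal_injective
    rw [Complex.ofReal_mul, hc, hc, Matrix.star_mulVec, ← Matrix.dotProduct_mulVec,
      Matrix.mulVec_mulVec, hmat z hz, Matrix.smul_mulVec, Matrix.one_mulVec, dotProduct_smul,
      smul_eq_mul, ← Complex.normSq_eq_norm_sq, ← Complex.mul_conj, mul_comm (eval z p₀)]
    rfl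
  have hNM : N ≤ M := by
    -- At a torus point with `p₀(z) ≠ 0` the matrix `Q₀(z)` is injective, which forces `N ≤ M`.
    obtain ⟨z, hz, hz0⟩ : ∃ z ∈ bitorus, eval z p₀ ≠ 0 := by
      by_contra! h
      rw [eq_zero_of_eval_bitorus h, mul_zero] at hpg
      exact hp hpg
    have hinj : Function.Injective (evalMatrix z Q₀).mulVecLin := by
      refine (injective_iff_map_eq_zero _).2 fun v hv => ?_
      have h1 := hT z hz v
      rw [← Matrix.mulVecLin_apply, hv] at h1
      have h2 : ∑ k, ‖v k‖ ^ 2 = 0 := by simpa [hz0] using h1.symm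
      ext k
      have := (Finset.sum_eq_zero_iff_of_nonneg fun i _ => sq_nonneg ‖v i‖).1 h2 k
        (Finset.mem_univ k)
      simpa using this
    simpa using LinearMap.finrank_le_finrank_of_injective hinj
  obtain ⟨n, hpn, hQn⟩ := exists_degree_bound Q₀ p₀
  obtain ⟨r, F, hbal, hFpow, hF0⟩ := exists_energy_balance Q₀ p₀ hp₀ hT hpn hQn
  obtain ⟨r, A, B, C, D, P₁, P₂, hU, hP₁, hP₂, hP, hreal⟩ :=
    exists_realization_of_energy_balance hNM Q₀ p₀ hp₀ hpn hQn r F hbal hFpow hF0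
  exact ⟨r, A, B, C, D, P₁, P₂, hU, hP₁, hP₂, hP, fun z =>
    ⟨(hreal z z.2).1, (hval z).2.trans (hreal z z.2).2⟩⟩
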